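/- Let $N$ be a number of particles with masses $m_1,\dots,m_N>0$ in $\mathbb R^3$, let $\alpha>2$, and let $\Delta=\{\mathbf x\in(\mathbb R^3)^N: x_i=x_j \text{ for some } i<j\}$. For $\mathbf x\notin\Delta$ and $\dot{\mathbf x}\in(\mathbb R^3)^N$ put $$U(\mathbf x)=-\sum_{i<j}\frac{m_im_j}{|x_i-x_j|^{\alpha}},\quad I(\mathbf x)=\sum_i m_i|x_i|^2,\quad E(\mathbf x,\dot{\mathbf x})=\tfrac12\sum_i m_i|\dot x_i|^2+U(\mathbf x),$$ and, for a frequency $\omega>0$, $$K_\omega(\mathbf x)=\omega^2I(\mathbf x)+\alpha U(\mathbf x),\qquad E_\omega(\mathbf x)=\tfrac{\omega^2}{2}I(\mathbf x)+U(\mathbf x),\qquad E^*(\omega)=\inf\{E_\omega(\mathbf x):\mathbf x\notin\Delta,\ K_\omega(\mathbf x)=0\},$$ $$\mathcal K^+(\omega)=\{(\mathbf x,\dot{\mathbf x}): \mathbf x\notin\Delta,\ E(\mathbf x,\dot{\mathbf x})<E^*(\omega),\ K_\omega(\mathbf x)\ge 0\},$$ $$\mathcal K^-(\omega)=\{(\mathbf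 x,\dot{\mathbf x}): \mathbf x\notin\Delta,\ E(\mathbf x,\dot{\mathbf x})<E^*(\omega),\ K_\omega(\mathbf x)<0\}.$$ Let $\mathbf x:[0,\sigma)\to(\mathbb R^3)^N\setminus\Delta$, $0<\sigma\le\infty$, be a maximal solution (one that cannot be extended to a longer interval $[0,\tau)$, $\tau>\sigma$) of the $N$-body equations $$m_i\ddot x_i=-\nabla_iU(\mathbf x)=-\alpha\sum_{j\ne i}\frac{m_im_j(x_i-x_j)}{|x_i-x_j|^{\alpha+2}},\qquad i=1,\dots,N.$$ The solution exists globally if $\sigma=\infty$, and has a singularity at $\sigma$ if $\sigma<\infty$; the singularity is a collision singularity if $\mathbf x(t)$ converges to a point of $\Delta$ as $t\to\sigma^-$. **Theorem 1.4 (Dichotomy below the excited energy).** For every $\omega>0$: 1. if there is $t^*\in(0,\sigma)$ such that $(\mathbf x(t),\dot{\mathbf x}(t))\in\mathcal K^+(\omega)$ for all $t\in(t^*,\sigma)$, then $\mathbf x$ exists globally; 2. if there is $t^*\in(0,\sigma)$ such that $(\mathbf x(t),\dot{\mathbf x}(t))\in\mathcal K^-(\omega)$ for all $t\in(t^*,\sigma)$,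 then $\mathbf x$ has a singularity (at the finite time $\sigma$). Moreover, every singularity of a maximal solution (whether or not the solution stays in one of these sets) is a collision singularity. -/

import Mathlib

namespace NBody

noncomputable section

/-- Physical space `ℝ³` with its Euclidean norm. -/
abbrev Space : Type := EuclideanSpace ℝ (Fin 3)

/-- `(ℝ³)^N`: positions (or velocities) of `N` particles. -/
abbrev Config (N : ℕ) : Type := Fin N → Space

/-- The collision set `Δ`: at least two particles occupy the same point. -/
def collisionSet (N : ℕ) : Set (Config N) :=
  {x | ∃ i j : Fin N, i < j ∧ x i = x j}

/-- The potential `U(x) = -∑_{i<j} m_i m_j / |x_i - x_j|^α`. -/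
def potential {N : ℕ} (α : ℝ) (m : Fin N → ℝ) (x : Config N) : ℝ :=
  -∑ i, ∑ j with i < j, m i * m j / ‖x i - x j‖ ^ α

/-- The force on particle `i`,
`-∇_i U(x) = -α ∑_{j ≠ i} m_i m_j (x_i - x_j) / |x_i - x_j|^(α+2)`. -/
def force {N : ℕ} (α : ℝ) (m : Fin N → ℝ) (x : Config N) (i : Fin N) : Space :=
  -(α • ∑ j with j ≠ i, (m i * m j / ‖x i - x j‖ ^ (α + 2)) • (x i - x j))

/-- The total energy `E(x, v) = ½ ∑ m_i |v_i|² + U(x)`. -/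
def energy {N : ℕ} (α : ℝ) (m : Fin N → ℝ) (x v : Config N) : ℝ :=
  1 / 2 * ∑ i, m i * ‖v i‖ ^ 2 + potential α m x

/-- The moment of inertia `I(x) = ∑ m_i |x_i|²`. -/
def inertia {N : ℕ} (m : Fin N → ℝ) (x : Config N) : ℝ :=
  ∑ i, m i * ‖x i‖ ^ 2

/-- The threshold function `K_ω(x) = ω² I(x) + α U(x)`. -/
def threshold {N : ℕ} (α : ℝ) (m : Fin N → ℝ) (ω : ℝ) (x : Config N) : ℝ :=
  ω ^ 2 * inertia m x + α * potential α m x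

/-- `E_ω(x) = (ω²/2) I(x) + U(x)`. -/
def rotatingEnergy {N : ℕ} (α : ℝ) (m : Fin N → ℝ) (ω : ℝ) (x : Config N) : ℝ :=
  ω ^ 2 / 2 * inertia m x + potential α m x

/-- The excited energy `E^*(ω) = inf {E_ω(x) : x ∉ Δ, K_ω(x) = 0}`, an infimum in the extended
reals. -/
def excitedEnergy {N : ℕ} (α : ℝ) (m : Fin N → ℝ) (ω : ℝ) : EReal :=
  sInf {e : EReal | ∃ x : Config N, x ∉ collisionSet N ∧ threshold α m ω x = 0 ∧
    e = (rotatingEnergy α m ω x : EReal)}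

/-- The set `𝒦⁺(ω)` in phase space. -/
def Kplus {N : ℕ} (α : ℝ) (m : Fin N → ℝ) (ω : ℝ) : Set (Config N × Config N) :=
  {p | p.1 ∉ collisionSet N ∧ (energy α m p.1 p.2 : EReal) < excitedEnergy α m ω ∧
    0 ≤ threshold α m ω p.1}

/-- The set `𝒦⁻(ω)` in phase space. -/
def Kminus {N : ℕ} (α : ℝ) (m : Fin N → ℝ) (ω : ℝ) : Set (Config N × Config N) :=
  {p | p.1 ∉ collisionSet N ∧ (energy α m p.1 p.2 : EReal) < excitedEnergy α m ω ∧
    threshold α m ω p.1 < 0}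

/-- The time interval `[0, σ)`, where `σ` may be `∞`. -/
def timeInterval (σ : EReal) : Set ℝ := {t | 0 ≤ t ∧ (t : EReal) < σ}

/-- `x`, with velocity `v`, solves the `N`-body equations `m_i x_i'' = -∇_i U(x)` on `[0, σ)`
(derivatives at time `0` are one-sided). -/
structure IsSolutionOn {N : ℕ} (α : ℝ) (m : Fin N → ℝ) (σ : EReal) (x v : ℝ → Config N) :
    Prop where
  noCollision : ∀ t ∈ timeInterval σ, x t ∉ collisionSet N
  hasDeriv_position : ∀ t ∈ timeInterval σ, HasDerivWithinAt x (v t) (timeInterval σ) t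
  hasDeriv_velocity : ∀ t ∈ timeInterval σ, ∃ a : Config N,
    HasDerivWithinAt v a (timeInterval σ) t ∧ ∀ i, m i • a i = force α m (x t) i

/-- `x`, with velocity `v`, is a solution on `[0, σ)` with `0 < σ ≤ ∞`, and `σ` is maximal: the
solution cannot be extended to a solution on a longer interval `[0, τ)`. -/
structure IsMaximalSolution {N : ℕ} (α : ℝ) (m : Fin N → ℝ) (σ : EReal) (x v : ℝ → Config N) :
    Prop where
  pos : 0 < σ
  isSolution : IsSolutionOn α m σ x v
  maximal : ∀ (τ : EReal) (y w : ℝ → Config N), IsSolutionOn α m τ y w →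
    Set.EqOn y x (timeInterval σ) → τ ≤ σ

/-- A solution with maximal time `σ` exists globally if `σ = ∞`. -/
def ExistsGlobally (σ : EReal) : Prop := σ = ⊤

/-- A solution with maximal time `σ` experiences a singularity at the finite time `T` if
`σ = T`. -/
def HasSingularityAt (σ : EReal) (T : ℝ) : Prop := σ = (T : EReal)

/-- The trajectory approaches a definite point of `Δ` as `t → T⁻`. -/
def ApproachesCollisionAt {N : ℕ} (x : ℝ → Config N) (T : ℝ) : Prop :=
  ∃ q ∈ collisionSet N, Filter.Tendsto x (nhdsWithin T (Set.Iio T)) (nhds q)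

/-- There is a time `t* > 0` in the interval of existence after which, as long as the solution
exists, the phase point stays in `S`. -/
def StaysEventuallyIn {N : ℕ} (σ : EReal) (x v : ℝ → Config N)
    (S : Set (Config N × Config N)) : Prop :=
  ∃ tstar : ℝ, 0 < tstar ∧ (tstar : EReal) < σ ∧
    ∀ t : ℝ, tstar < t → (t : EReal) < σ → (x t, v t) ∈ S

end

end NBody

/-!
Along a maximal solution with finite lifetime `T`, the potential `U` tends to `-∞` as `t → T⁻`
(`IsMaximalSolution.tendsto_potential`): at a time where `U ≥ -R` the particles are separated and,
by conservation of energy, slow, so they stay separated for a time that depends on `R` only; if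
that time reached `T`, then positions and velocities would converge and the Picard–Lindelöf theorem
would extend the solution.

The Lagrange–Jacobi identity reads `I'' = 4 E + (2 α - 4) U`. Since `α > 2`, the moment of inertia
`I` is concave near `T`, hence it converges and the trajectory is bounded. It remains to see that a
limit point `q` of `x(t)` is the limit (`SolvesOn.tendsto_of_mapClusterPt`); it lies in `Δ` because
`U → -∞`. Group the particles into the clusters of `q`, let `c` be the configuration in which each
particle sits at the centre of mass of its cluster, and write `I = |c|² + J` in the mass norm, with
`J ≥ 0` the inertia of the clusters about their centres. Near `q` the acceleration `c''` is
bounded, since the forces inside a cluster cancel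
(`exists_norm_clusterCenter_acceleration_le`), and therefore `J` is concave there, as `I''` is very
negative (`SolvesOn.concaveOn_clusterInertia`). If the trajectory left a fixed ball around `q`
infinitely often, consider an excursion `[a, b]` between two visits to the sphere, with a time `t`
inside at which `x(t)` is very close to `q`, so that `J(t)` is tiny. By concavity `J ≤ J(t)` on
`[a, t]` or on `[t, b]`. On that interval `|c|² = I - J` is nearly constant, so `c` lies close to a
sphere, while the path of `c` is nearly straight because the interval is short and `c''` is
bounded; hence `c` moves little (`norm_sub_sq_le_of_nearly_straight`). But it connects a point
near `q` with a point at a fixed distance from `q`: a contradiction.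

The dichotomy follows. If `σ = T < ∞`, the solution converges, so `I` is bounded and `K_ω → -∞`,
which excludes `𝒦⁺(ω)`. On `𝒦⁻(ω)`, dilating the configuration until `K_ω = 0` shows
`E^*(ω) ≤ -(α/2 - 1) U` (`excitedEnergy_le`), so `I'' ≤ 4 (E - e) < 0` for any real `e` strictly
between `E` and `E^*(ω)`; if `σ = ∞` this would make `I` negative.
-/

namespace NBody

open Set Filter Topology
open scoped RealInnerProductSpace

/-! ### Calculus on intervals -/

section Calculus

variable {E : Type*} [NormedAddCommGroup E] [NormedSpace ℝ E]

theorem exists_tendsto_of_deriv_bounded [CompleteSpace E] {f f' : ℝ → E} {s T C : ℝ} (hs : s < T)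
    (hf : ∀ t ∈ Ioo s T, HasDerivAt f (f' t) t) (hC : ∀ t ∈ Ioo s T, ‖f' t‖ ≤ C) :
    ∃ l, Tendsto f (𝓝[<] T) (𝓝 l) := by
  have hlip : LipschitzOnWith C.toNNReal f (Ioo s T) :=
    (convex_Ioo s T).lipschitzOnWith_of_nnnorm_hasDerivWithin_le
      (fun t ht => (hf t ht).hasDerivWithinAt)
      (fun t ht => NNReal.le_toNNReal_of_coe_le (hC t ht))
  have hc : Cauchy (map f (𝓝[Ioo s T] T)) := by
    have : (𝓝[Ioo s T] T).NeBot := by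
      rw [nhdsWithin_Ioo_eq_nhdsLT hs]; infer_instance
    refine ⟨inferInstance, ?_⟩
    have hu := hlip.uniformContinuousOn
    rw [prod_map_map_eq]
    refine Tendsto.mono_left hu (le_inf ?_ ?_)
    · exact ((cauchy_nhds (a := T)).mono nhdsWithin_le_nhds).2
    · rw [nhdsWithin, le_principal_iff]
      exact prod_mem_prod (mem_inf_of_right (mem_principal_self _))
        (mem_inf_of_right (mem_principal_self _))
  rw [nhdsWithin_Ioo_eq_nhdsLT hs] at hc
  exact CompleteSpace.complete hc

/-- Two curves glued at time `T` are differentiable there if the first one and its derivative have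
the value and the derivative of the second one as left limits. -/
theorem hasDerivAt_ite_lt {f f' g : ℝ → E} {g' : E} {s T : ℝ} (hs : s < T)
    (hf : ∀ t ∈ Ioo s T, HasDerivAt f (f' t) t) (hlim : Tendsto f (𝓝[<] T) (𝓝 (g T)))
    (hlim' : Tendsto f' (𝓝[<] T) (𝓝 g')) (hg : HasDerivAt g g' T) :
    HasDerivAt (fun t => if t < T then f t else g t) g' T := by
  have hmem : Ioo s T ∈ 𝓝[<] T := Ioo_mem_nhdsLT hs
  have hd : ∀ t ∈ Ioo s T, HasDerivAt (fun t => if t < T then f t else g t) (f' t) t := by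
    intro t ht
    refine (hf t ht).congr_of_eventuallyEq ?_
    filter_upwards [eventually_lt_nhds ht.2] with u hu using if_pos hu
  have hleft : HasDerivWithinAt (fun t => if t < T then f t else g t) g' (Iic T) T := by
    refine hasDerivWithinAt_Iic_of_tendsto_deriv
      (fun t ht => (hd t ht).differentiableAt.differentiableWithinAt) ?_ hmem ?_
    · rw [ContinuousWithinAt, nhdsWithin_Ioo_eq_nhdsLT hs, if_neg (lt_irrefl T)]
      refine hlim.congr' ?_
      filter_upwards [hmem] with u hu using (if_pos hu.2).symm
    · refine hlim'.congr' ?_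
      filter_upwards [hmem] with u hu using (hd u hu).deriv.symm
  have hright : HasDerivWithinAt (fun t => if t < T then f t else g t) g' (Ici T) T :=
    hg.hasDerivWithinAt.congr (fun u hu => if_neg (not_lt.2 hu)) (if_neg (lt_irrefl T))
  have := hleft.union hright
  rwa [Iic_union_Ici, hasDerivWithinAt_univ] at this

theorem antitoneOn_of_hasDerivAt_nonpos {D : Set ℝ} (hD : Convex ℝ D) {f f' : ℝ → ℝ}
    (hf : ∀ t ∈ D, HasDerivAt f (f' t) t) (h : ∀ t ∈ D, f' t ≤ 0) : AntitoneOn f D :=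
  antitoneOn_of_deriv_nonpos hD (fun t ht => (hf t ht).continuousAt.continuousWithinAt)
    (fun t ht => (hf t (interior_subset ht)).differentiableAt.differentiableWithinAt)
    (fun t ht => by rw [(hf t (interior_subset ht)).deriv]; exact h t (interior_subset ht))

/-- A nonnegative concave function on a bounded interval has a limit at the right end. -/
theorem exists_tendsto_of_deriv2_nonpos {f f' f'' : ℝ → ℝ} {s T : ℝ} (hs : s < T)
    (hf : ∀ t ∈ Ioo s T, HasDerivAt f (f' t) t) (hf' : ∀ t ∈ Ioo s T, HasDerivAt f' (f'' t) t)
    (h : ∀ t ∈ Ioo s T, f'' t ≤ 0) (hpos : ∀ t ∈ Ioo s T, 0 ≤ f t) :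
    ∃ l, Tendsto f (𝓝[<] T) (𝓝 l) := by
  have hanti := antitoneOn_of_hasDerivAt_nonpos (convex_Ioo s T) hf' h
  by_cases hneg : ∃ p ∈ Ioo s T, f' p ≤ 0
  · obtain ⟨p, hp, hp0⟩ := hneg
    have hsub : Ioo p T ⊆ Ioo s T := Ioo_subset_Ioo_left hp.1.le
    have hfa : AntitoneOn f (Ioo p T) := antitoneOn_of_hasDerivAt_nonpos (convex_Ioo p T)
      (fun t ht => hf t (hsub ht)) fun t ht => (hanti hp (hsub ht) ht.1.le).trans hp0
    exact ⟨_, hfa.tendsto_nhdsWithin_Ioo_left (nonempty_Ioo.2 hp.2)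
      ⟨0, by rintro _ ⟨t, ht, rfl⟩; exact hpos t (hsub ht)⟩⟩
  · push Not at hneg
    obtain ⟨p, hp⟩ := nonempty_Ioo.2 hs
    have hsub : Ioo p T ⊆ Ioo s T := Ioo_subset_Ioo_left hp.1.le
    have hfm : MonotoneOn f (Ioo p T) := by
      have := antitoneOn_of_hasDerivAt_nonpos (convex_Ioo p T) (f := fun t => -f t)
        (fun t ht => (hf t (hsub ht)).neg) fun t ht => by linarith [hneg t (hsub ht)]
      simpa using this.neg
    refine ⟨_, hfm.tendsto_nhdsWithin_Ioo_left (nonempty_Ioo.2 hp.2) ⟨f p + f' p * (T - p), ?_⟩⟩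
    rintro _ ⟨t, ht, rfl⟩
    have hco : ∀ u ∈ Icc p t, u ∈ Ioo s T := fun u hu =>
      ⟨hp.1.trans_le hu.1, hu.2.trans_lt ht.2⟩
    have hlin : AntitoneOn (fun u => f u - f' p * u) (Icc p t) :=
      antitoneOn_of_hasDerivAt_nonpos (convex_Icc p t)
        (fun u hu => (hf u (hco u hu)).sub ((hasDerivAt_id u).const_mul (f' p)))
        fun u hu => by linarith [hanti hp (hco u hu) hu.1]
    have h1 := hlin (left_mem_Icc.2 ht.1.le) (right_mem_Icc.2 ht.1.le) ht.1.le
    have h2 := mul_le_mul_of_nonneg_left ht.2.le (hneg p hp).le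
    simp only at h1
    linarith

theorem exists_first_hit {f : ℝ → ℝ} {t s r : ℝ} (hts : t ≤ s) (hf : ContinuousOn f (Icc t s))
    (ht : f t < r) (hs : r ≤ f s) : ∃ b ∈ Ioc t s, f b = r ∧ ∀ u ∈ Icc t b, f u ≤ r := by
  have hcl : IsClosed (Icc t s ∩ f ⁻¹' Ici r) := hf.preimage_isClosed_of_isClosed isClosed_Icc
    isClosed_Ici
  obtain ⟨b, hb⟩ := (isCompact_Icc.of_isClosed_subset hcl inter_subset_left).exists_isLeast
    ⟨s, right_mem_Icc.2 hts, hs⟩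
  have htb : t < b := by
    refine lt_of_le_of_ne hb.1.1.1 ?_
    rintro rfl
    exact absurd hb.1.2 (not_le.2 ht)
  have hlt : ∀ u ∈ Ico t b, f u < r := fun u hu =>
    not_le.1 fun h => not_le.2 hu.2 (hb.2 ⟨⟨hu.1, hu.2.le.trans hb.1.1.2⟩, h⟩)
  have hbr : f b = r := by
    obtain ⟨u, hu, hur⟩ := intermediate_value_Icc htb.le
      (hf.mono (Icc_subset_Icc_right hb.1.1.2)) ⟨ht.le, hb.1.2⟩
    rcases hu.2.lt_or_eq with h | h
    · exact absurd hur (hlt u ⟨hu.1, h⟩).ne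
    · rwa [← h]
  refine ⟨b, ⟨htb, hb.1.1.2⟩, hbr, fun u hu => ?_⟩
  rcases hu.2.lt_or_eq with h | h
  · exact (hlt u ⟨hu.1, h⟩).le
  · rw [h, hbr]

theorem exists_last_hit {f : ℝ → ℝ} {t s r : ℝ} (hst : s ≤ t) (hf : ContinuousOn f (Icc s t))
    (ht : f t < r) (hs : r ≤ f s) : ∃ a ∈ Ico s t, f a = r ∧ ∀ u ∈ Icc a t, f u ≤ r := by
  obtain ⟨b, hb, hbr, hle⟩ := exists_first_hit (f := fun u => f (-u)) (neg_le_neg hst)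
    (hf.comp continuousOn_neg fun u hu => ⟨by linarith [hu.2], by linarith [hu.1]⟩)
    (by simpa using ht) (by simpa using hs)
  refine ⟨-b, ⟨by linarith [hb.2], by linarith [hb.1]⟩, hbr, fun u hu => ?_⟩
  simpa using hle (-u) ⟨by linarith [hu.2], by linarith [hu.1]⟩

theorem concaveOn_le_left_or_le_right {f : ℝ → ℝ} {a b t : ℝ} (hf : ConcaveOn ℝ (Icc a b) f) :
    (∀ u ∈ Icc a t, t ≤ b → f u ≤ f t) ∨ (∀ u ∈ Icc t b, a ≤ t → f u ≤ f t) := by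
  by_contra! h
  obtain ⟨⟨u, hu, htb, hut⟩, w, hw, hat, hwt⟩ := h
  have := hf.min_le_of_mem_Icc ⟨hu.1, hu.2.trans htb⟩ ⟨hat.trans hw.1, hw.2⟩ ⟨hu.2, hw.1⟩
  exact absurd this (not_le.2 (lt_min hut hwt))

theorem not_deriv2_le_neg {f f' f'' : ℝ → ℝ} {s c : ℝ} (hc : 0 < c)
    (hf : ∀ t ∈ Ici s, HasDerivAt f (f' t) t) (hf' : ∀ t ∈ Ici s, HasDerivAt f' (f'' t) t)
    (h : ∀ t ∈ Ici s, f'' t ≤ -c) : ¬ ∀ t ∈ Ici s, 0 ≤ f t := by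
  intro hpos
  have h1 : AntitoneOn (fun t => f' t + c * t) (Ici s) :=
    antitoneOn_of_hasDerivAt_nonpos (convex_Ici s)
      (fun t ht => (hf' t ht).add ((hasDerivAt_id t).const_mul c))
      fun t ht => by linarith [h t ht]
  have h2 : AntitoneOn (fun t => f t - (f' s * t - c / 2 * (t - s) ^ 2)) (Ici s) := by
    refine antitoneOn_of_hasDerivAt_nonpos (convex_Ici s)
      (fun t ht => (hf t ht).sub (((hasDerivAt_id t).const_mul (f' s)).sub
        ((((hasDerivAt_id t).sub_const s).pow 2).const_mul (c / 2)))) fun t ht => ?_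
    have := h1 self_mem_Ici ht ht
    simp only [id, Nat.cast_ofNat, pow_one, Nat.add_one_sub_one, mul_one] at this ⊢
    linarith
  -- By `h2`, `f (s + u) ≤ f s + f' s * u - c / 2 * u ^ 2`, which is negative for this `u`.
  obtain ⟨u, hu⟩ : ∃ u, u = 1 + 2 * (|f s| + |f' s|) / c := ⟨_, rfl⟩
  have hu1 : 1 ≤ u := by
    have : 0 ≤ 2 * (|f s| + |f' s|) / c := by positivity
    linarith
  have hmem : s + u ∈ Ici s := by rw [mem_Ici]; linarith
  have h3 := h2 self_mem_Ici hmem hmem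
  have h4 := hpos (s + u) hmem
  have h5 : c * u = c + 2 * (|f s| + |f' s|) := by rw [hu]; field_simp
  have h6 : c / 2 * u ^ 2 = (c / 2 + (|f s| + |f' s|)) * u := by
    rw [sq, ← mul_assoc, div_mul_eq_mul_div, h5]; ring
  have h7 : f' s * u ≤ |f' s| * u := by gcongr; exact le_abs_self _
  have h8 : f s ≤ |f s| * u := (le_abs_self _).trans (le_mul_of_one_le_right (abs_nonneg _) hu1)
  have h9 : 0 < c * u := by positivity
  simp only [add_sub_cancel_left, sub_self] at h3
  rw [h6] at h3
  linarith

end Calculus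

/-! ### Nearly straight paths near a sphere -/

section InnerProduct

variable {V : Type*} [NormedAddCommGroup V] [InnerProductSpace ℝ V]

/-- The bound comes from the mean value inequality, applied to `t ↦ c (t + h) - c t`. -/
theorem norm_second_difference_le {c c' c'' : ℝ → V} {a h C : ℝ} (hh : 0 ≤ h)
    (hc : ∀ t ∈ Icc a (a + 2 * h), HasDerivAt c (c' t) t)
    (hc' : ∀ t ∈ Icc a (a + 2 * h), HasDerivAt c' (c'' t) t)
    (hC : ∀ t ∈ Icc a (a + 2 * h), ‖c'' t‖ ≤ C) :
    ‖c a + c (a + 2 * h) - (2 : ℝ) • c (a + h)‖ ≤ C * h * h := by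
  have hd : ∀ t ∈ Icc a (a + h), HasDerivWithinAt (fun t => c (t + h) - c t)
      (c' (t + h) - c' t) (Icc a (a + h)) t := fun t ht =>
    (((hc (t + h) ⟨by linarith [ht.1], by linarith [ht.2]⟩).comp_add_const t h).sub
      (hc t ⟨ht.1, by linarith [ht.2]⟩)).hasDerivWithinAt
  have hb : ∀ t ∈ Icc a (a + h), ‖c' (t + h) - c' t‖ ≤ C * h := by
    intro t ht
    have := (convex_Icc a (a + 2 * h)).norm_image_sub_le_of_norm_hasDerivWithin_le
      (fun u hu => (hc' u hu).hasDerivWithinAt) hC (x := t) (y := t + h)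
      ⟨ht.1, by linarith [ht.2]⟩ ⟨by linarith [ht.1], by linarith [ht.2]⟩
    simpa [abs_of_nonneg hh] using this
  have := (convex_Icc a (a + h)).norm_image_sub_le_of_norm_hasDerivWithin_le hd hb
    (x := a) (y := a + h) ⟨le_rfl, by linarith⟩ ⟨by linarith, le_rfl⟩
  rw [add_sub_cancel_left, Real.norm_of_nonneg hh] at this
  convert this using 2
  rw [two_smul, show a + h + h = a + 2 * h by ring]
  abel

/-- If `A` and `B` lie inside a ball (up to `δ`), and a point `M` close to their midpoint does not
lie deep inside, then `A` and `B` are close: strict convexity of the ball, by the parallelogram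
law. -/
theorem norm_sub_sq_le_of_near_sphere {A B M : V} {I δ k R : ℝ}
    (hA : ‖A‖ ^ 2 ≤ I + δ) (hB : ‖B‖ ^ 2 ≤ I + δ) (hM : I - 2 * δ ≤ ‖M‖ ^ 2)
    (hAR : ‖A‖ ≤ R) (hBR : ‖B‖ ≤ R) (hk : ‖A + B - (2 : ℝ) • M‖ ≤ k) :
    ‖A - B‖ ^ 2 ≤ 12 * δ + 4 * k * R + k ^ 2 := by
  have hpar := parallelogram_law_with_norm ℝ A B
  have hk0 : 0 ≤ k := (norm_nonneg _).trans hk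
  have h1 : 2 * ‖M‖ ≤ ‖A + B‖ + k := by
    have : ‖(2 : ℝ) • M‖ ≤ ‖A + B‖ + ‖A + B - (2 : ℝ) • M‖ := norm_le_norm_add_norm_sub _ _
    rw [norm_smul, Real.norm_ofNat] at this
    linarith
  have h2 : ‖A + B‖ ≤ 2 * R := (norm_add_le A B).trans (by linarith)
  have h3 : (2 * ‖M‖) ^ 2 ≤ (‖A + B‖ + k) ^ 2 := by gcongr
  have h4 := mul_le_mul_of_nonneg_left h2 hk0
  nlinarith

/-- A nearly straight path in a thin shell around a sphere is short. -/
theorem norm_sub_sq_le_of_nearly_straight {c c' c'' : ℝ → V} {a b I δ C R : ℝ} (hab : a ≤ b)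
    (hc : ∀ t ∈ Icc a b, HasDerivAt c (c' t) t) (hc' : ∀ t ∈ Icc a b, HasDerivAt c' (c'' t) t)
    (hC0 : 0 ≤ C) (hR0 : 0 ≤ R) (hC : ∀ t ∈ Icc a b, ‖c'' t‖ ≤ C)
    (hR : ∀ t ∈ Icc a b, ‖c t‖ ≤ R) (hup : ∀ t ∈ Icc a b, ‖c t‖ ^ 2 ≤ I + δ)
    (hlow : ∀ t ∈ Icc a b, I - 2 * δ ≤ ‖c t‖ ^ 2) (h1 : C * (b - a) * (b - a) ≤ 1)
    (hδ : (4 * R + 1) * (C * (b - a) * (b - a)) ≤ δ) : ‖c a - c b‖ ^ 2 ≤ 13 * δ := by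
  obtain ⟨k, rfl⟩ : ∃ k, b = a + 2 * k := ⟨(b - a) / 2, by ring⟩
  have hk0 : 0 ≤ k := by linarith
  have hm : a + k ∈ Icc a (a + 2 * k) := ⟨by linarith, by linarith⟩
  have hfinal := norm_sub_sq_le_of_near_sphere (hup a (left_mem_Icc.2 hab))
    (hup _ (right_mem_Icc.2 hab)) (hlow _ hm) (hR a (left_mem_Icc.2 hab))
    (hR _ (right_mem_Icc.2 hab)) (norm_second_difference_le hk0 hc hc' hC)
  rw [add_sub_cancel_left] at h1 hδ
  have hw0 : 0 ≤ C * k * k := by positivity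
  have hw : C * k * k ≤ C * (2 * k) * (2 * k) := by linarith
  have hw2 : (C * k * k) ^ 2 ≤ C * k * k := by
    rw [sq]; exact mul_le_of_le_one_left hw0 (hw.trans h1)
  have hw3 : (4 * R + 1) * (C * k * k) ≤ (4 * R + 1) * (C * (2 * k) * (2 * k)) := by gcongr
  linarith

end InnerProduct

variable {N : ℕ} {α : ℝ} {m : Fin N → ℝ}

/-! ### Potential and force -/

/-- The acceleration `x_i'' = m_i⁻¹ F_i(x)` of each particle. -/
noncomputable def acceleration (α : ℝ) (m : Fin N → ℝ) (x : Config N) : Config N :=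
  fun i => (m i)⁻¹ • force α m x i

theorem ne_of_notMem_collisionSet {x : Config N} (hx : x ∉ collisionSet N) {i j : Fin N}
    (hij : i ≠ j) : x i ≠ x j := by
  intro h
  rcases lt_or_gt_of_ne hij with h' | h'
  · exact hx ⟨i, j, h', h⟩
  · exact hx ⟨j, i, h', h.symm⟩

theorem sum_ne_eq_sum_lt {M : Type*} [AddCommMonoid M] (g : Fin N → Fin N → M) :
    ∑ i, ∑ j with j ≠ i, g i j = ∑ i, ∑ j with i < j, (g i j + g j i) := by
  have h1 : ∀ i, ∑ j with j ≠ i, g i j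
      = (∑ j, if i < j then g i j else 0) + ∑ j, if j < i then g i j else 0 := by
    intro i
    rw [Finset.sum_filter, ← Finset.sum_add_distrib]
    refine Finset.sum_congr rfl fun j _ => ?_
    rcases lt_trichotomy i j with h | h | h
    · simp [h, h.ne', h.not_gt]
    · simp [h]
    · simp [h, h.ne, h.not_gt]
  simp_rw [h1, Finset.sum_add_distrib, Finset.sum_filter]
  congr 1
  rw [Finset.sum_comm]

/-- The power of the forces along `y`, with action and reaction paired. Taking for `y` the velocity
gives conservation of energy, taking `x` itself gives the virial identity, and taking a
configuration that is constant on clusters shows that the forces inside clusters cancel. -/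
theorem sum_inner_force (α : ℝ) (m : Fin N → ℝ) (x y : Config N) :
    ∑ i, ⟪force α m x i, y i⟫ =
      -(α * ∑ i, ∑ j with i < j,
        m i * m j / ‖x i - x j‖ ^ (α + 2) * ⟪x i - x j, y i - y j⟫) := by
  have h : ∀ i, ⟪force α m x i, y i⟫ =
      -(α * ∑ j with j ≠ i, m i * m j / ‖x i - x j‖ ^ (α + 2) * ⟪x i - x j, y i⟫) := by
    intro i
    simp only [force, inner_neg_left, real_inner_smul_left, sum_inner]
  simp_rw [h]
  rw [Finset.sum_neg_distrib, ← Finset.mul_sum, sum_ne_eq_sum_lt]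
  congr 2
  refine Finset.sum_congr rfl fun i _ => Finset.sum_congr rfl fun j _ => ?_
  rw [norm_sub_rev (x j) (x i), ← neg_sub (x i) (x j), inner_neg_left, inner_sub_right]
  ring

/-- Euler's identity for the potential, which is homogeneous of degree `-α`. -/
theorem sum_inner_force_self {x : Config N} (hx : x ∉ collisionSet N) :
    ∑ i, ⟪force α m x i, x i⟫ = α * potential α m x := by
  rw [sum_inner_force, potential, mul_neg]
  congr 2
  refine Finset.sum_congr rfl fun i _ => Finset.sum_congr rfl fun j hj => ?_
  have hij : i < j := by simpa using hj
  have hpos : 0 < ‖x i - x j‖ :=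
    norm_pos_iff.2 (sub_ne_zero.2 (ne_of_notMem_collisionSet hx hij.ne))
  rw [real_inner_self_eq_norm_sq, Real.rpow_add hpos, Real.rpow_two]
  field_simp

theorem hasDerivAt_potential {x : ℝ → Config N} {v : Config N} {t : ℝ}
    (hx : x t ∉ collisionSet N) (h : HasDerivAt x v t) :
    HasDerivAt (fun s => potential α m (x s)) (-∑ i, ⟪force α m (x t) i, v i⟫) t := by
  rw [sum_inner_force, Finset.mul_sum, ← Finset.sum_neg_distrib, ← Finset.sum_neg_distrib]
  unfold potential
  simp_rw [← Finset.sum_neg_distrib]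
  refine HasDerivAt.fun_sum fun i _ => ?_
  rw [neg_neg, Finset.mul_sum]
  refine HasDerivAt.fun_sum fun j hj => ?_
  have hij : i < j := by simpa using hj
  have hpos : 0 < ‖x t i - x t j‖ :=
    norm_pos_iff.2 (sub_ne_zero.2 (ne_of_notMem_collisionSet hx hij.ne))
  have hd : HasDerivAt (fun s => x s i - x s j) (v i - v j) t :=
    ((hasDerivAt_pi.1 h) i).sub ((hasDerivAt_pi.1 h) j)
  have h2 := (hd.norm_sq.rpow_const (p := -(α / 2))
    (Or.inl (pow_pos hpos 2).ne')).const_mul (-(m i * m j))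
  refine (h2.congr_of_eventuallyEq (Eventually.of_forall fun s => ?_)).congr_deriv ?_
  · have : (‖x s i - x s j‖ ^ 2) ^ (-(α / 2)) = (‖x s i - x s j‖ ^ α)⁻¹ := by
      rw [← Real.rpow_natCast, ← Real.rpow_mul (norm_nonneg _), ← Real.rpow_neg (norm_nonneg _)]
      congr 1; push_cast; ring
    simp only [this]; ring
  · have : (‖x t i - x t j‖ ^ 2) ^ (-(α / 2) - 1) = (‖x t i - x t j‖ ^ (α + 2))⁻¹ := by
      rw [← Real.rpow_natCast, ← Real.rpow_mul (norm_nonneg _), ← Real.rpow_neg (norm_nonneg _)]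
      congr 1; push_cast; ring
    rw [this]; ring

theorem neg_potential_term_nonneg (hm : ∀ i, 0 < m i) (x : Config N) (i j : Fin N) :
    0 ≤ m i * m j / ‖x i - x j‖ ^ α := by
  have := hm i; have := hm j; positivity

theorem term_le_neg_potential (hm : ∀ i, 0 < m i) (x : Config N) {i j : Fin N} (hij : i < j) :
    m i * m j / ‖x i - x j‖ ^ α ≤ -potential α m x := by
  rw [potential, neg_neg]
  calc m i * m j / ‖x i - x j‖ ^ α
      ≤ ∑ j with i < j, m i * m j / ‖x i - x j‖ ^ α :=
        Finset.single_le_sum (f := fun j => m i * m j / ‖x i - x j‖ ^ α)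
          (fun j _ => neg_potential_term_nonneg hm x i j) (by simpa using hij)
    _ ≤ _ := Finset.single_le_sum (f := fun i => ∑ j with i < j, m i * m j / ‖x i - x j‖ ^ α)
          (fun i _ => Finset.sum_nonneg fun j _ => neg_potential_term_nonneg hm x i j)
          (Finset.mem_univ i)

theorem potential_smul (α : ℝ) (m : Fin N → ℝ) (x : Config N) {l : ℝ} (hl : 0 < l) :
    potential α m (l • x) = l ^ (-α) * potential α m x := by
  simp only [potential, mul_neg, Finset.mul_sum]
  congr 1
  refine Finset.sum_congr rfl fun i _ => Finset.sum_congr rfl fun j _ => ?_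
  rw [Pi.smul_apply, Pi.smul_apply, ← smul_sub, norm_smul, Real.norm_of_nonneg hl.le,
    Real.mul_rpow hl.le (norm_nonneg _), Real.rpow_neg hl.le]
  field_simp

theorem inertia_smul (m : Fin N → ℝ) (x : Config N) (l : ℝ) :
    inertia m (l • x) = l ^ 2 * inertia m x := by
  simp only [inertia, Finset.mul_sum]
  refine Finset.sum_congr rfl fun i _ => ?_
  rw [Pi.smul_apply, norm_smul, mul_pow, Real.norm_eq_abs, sq_abs]; ring

theorem smul_notMem_collisionSet {x : Config N} (hx : x ∉ collisionSet N) {l : ℝ} (hl : l ≠ 0) :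
    l • x ∉ collisionSet N := by
  rintro ⟨i, j, hij, h⟩
  exact hx ⟨i, j, hij, smul_right_injective _ hl h⟩

theorem contDiffAt_inv_norm_rpow {z : Space} (hz : z ≠ 0) (p : ℝ) :
    ContDiffAt ℝ 1 (fun y : Space => (‖y‖ ^ p)⁻¹) z := by
  have h : ContDiffAt ℝ 1 (fun y : Space => ‖y‖) z := contDiffAt_id.norm ℝ hz
  exact (h.rpow_const_of_ne (norm_ne_zero_iff.2 hz)).inv
    (Real.rpow_pos_of_pos (norm_pos_iff.2 hz) p).ne'

theorem contDiffAt_acceleration {x : Config N} (hx : x ∉ collisionSet N) :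
    ContDiffAt ℝ 1 (acceleration α m) x := by
  rw [contDiffAt_pi]
  intro i
  unfold acceleration force
  refine ContDiffAt.const_smul _ (ContDiffAt.neg (ContDiffAt.const_smul _
    (ContDiffAt.sum fun j hj => ?_)))
  have hij : j ≠ i := by simpa using hj
  have hd : ContDiffAt ℝ 1 (fun y : Config N => y i - y j) x := by fun_prop
  have hr := (contDiffAt_inv_norm_rpow
    (sub_ne_zero.2 (ne_of_notMem_collisionSet hx hij.symm)) (α + 2)).comp x hd
  simp only [div_eq_mul_inv]
  exact (contDiffAt_const.mul hr).smul hd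

theorem continuousAt_potential {x : Config N} (hx : x ∉ collisionSet N) :
    ContinuousAt (potential α m) x := by
  unfold potential
  refine ContinuousAt.neg (tendsto_finsetSum _ fun i _ => tendsto_finsetSum _ fun j hj => ?_)
  have hij : i < j := by simpa using hj
  have hpos : 0 < ‖x i - x j‖ :=
    norm_pos_iff.2 (sub_ne_zero.2 (ne_of_notMem_collisionSet hx hij.ne))
  have hd : ContinuousAt (fun y : Config N => ‖y i - y j‖) x := by fun_prop
  exact ContinuousAt.div continuousAt_const (hd.rpow_const (Or.inl hpos.ne'))
    (Real.rpow_pos_of_pos hpos α).ne'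

theorem isClosed_collisionSet (N : ℕ) : IsClosed (collisionSet N) := by
  have : collisionSet N = ⋃ i, ⋃ j, {x : Config N | i < j ∧ x i = x j} := by
    ext x; simp [collisionSet]
  rw [this]
  refine isClosed_iUnion_of_finite fun i => isClosed_iUnion_of_finite fun j => ?_
  by_cases hij : i < j
  · simpa [hij] using isClosed_eq (continuous_apply i) (continuous_apply j)
  · simp [hij]

/-! ### Solutions: energy and the Lagrange–Jacobi identity -/

/-- On the set of times `s`, the motion `x` with velocity `v` avoids collisions and satisfies
Newton's equations. All derivatives are two-sided: the set `s` will not contain the initial time. -/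
structure SolvesOn (α : ℝ) (m : Fin N → ℝ) (s : Set ℝ) (x v : ℝ → Config N) : Prop where
  notMem : ∀ t ∈ s, x t ∉ collisionSet N
  position : ∀ t ∈ s, HasDerivAt x (v t) t
  velocity : ∀ t ∈ s, HasDerivAt v (acceleration α m (x t)) t

theorem SolvesOn.mono {s s' : Set ℝ} {x v : ℝ → Config N} (h : SolvesOn α m s x v)
    (hs : s' ⊆ s) : SolvesOn α m s' x v :=
  ⟨fun t ht => h.notMem t (hs ht), fun t ht => h.position t (hs ht),
    fun t ht => h.velocity t (hs ht)⟩

theorem timeInterval_mem_nhds {σ : EReal} {t : ℝ} (h0 : 0 < t) (ht : (t : EReal) < σ) :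
    timeInterval σ ∈ 𝓝 t := by
  have h1 : ∀ᶠ s : ℝ in 𝓝 t, (s : EReal) < σ :=
    (continuous_coe_real_ereal.tendsto t).eventually (eventually_lt_nhds ht)
  filter_upwards [h1, eventually_gt_nhds h0] with s hs hs' using ⟨hs'.le, hs⟩

theorem eq_acceleration (hm : ∀ i, 0 < m i) {x a : Config N}
    (h : ∀ i, m i • a i = force α m x i) : a = acceleration α m x := by
  funext i
  rw [acceleration, ← h i, inv_smul_smul₀ (hm i).ne']

theorem smul_acceleration (hm : ∀ i, 0 < m i) (x : Config N) (i : Fin N) :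
    m i • acceleration α m x i = force α m x i := by
  rw [acceleration, smul_inv_smul₀ (hm i).ne']

theorem IsSolutionOn.solvesOn (hm : ∀ i, 0 < m i) {σ : EReal} {x v : ℝ → Config N}
    (h : IsSolutionOn α m σ x v) : SolvesOn α m {t | 0 < t ∧ (t : EReal) < σ} x v where
  notMem t ht := h.noCollision t ⟨ht.1.le, ht.2⟩
  position t ht := (h.hasDeriv_position t ⟨ht.1.le, ht.2⟩).hasDerivAt
    (timeInterval_mem_nhds ht.1 ht.2)
  velocity t ht := by
    obtain ⟨a, ha, hf⟩ := h.hasDeriv_velocity t ⟨ht.1.le, ht.2⟩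
    rw [eq_acceleration hm hf] at ha
    exact ha.hasDerivAt (timeInterval_mem_nhds ht.1 ht.2)

theorem SolvesOn.hasDerivAt_energy (hm : ∀ i, 0 < m i) {s : Set ℝ} {x v : ℝ → Config N}
    (h : SolvesOn α m s x v) {t : ℝ} (ht : t ∈ s) :
    HasDerivAt (fun t => energy α m (x t) (v t)) 0 t := by
  have hK : HasDerivAt (fun t => 1 / 2 * ∑ i, m i * ‖v t i‖ ^ 2)
      (1 / 2 * ∑ i, m i * (2 * ⟪v t i, acceleration α m (x t) i⟫)) t := by
    refine HasDerivAt.const_mul _ (HasDerivAt.fun_sum fun i _ => HasDerivAt.const_mul _ ?_)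
    exact ((hasDerivAt_pi.1 (h.velocity t ht)) i).norm_sq
  refine (hK.add (hasDerivAt_potential (h.notMem t ht) (h.position t ht))).congr_deriv ?_
  rw [Finset.mul_sum, ← Finset.sum_neg_distrib, ← Finset.sum_add_distrib]
  refine Finset.sum_eq_zero fun i _ => ?_
  rw [← smul_acceleration hm, real_inner_smul_left, real_inner_comm]
  ring

theorem SolvesOn.exists_energy_eq (hm : ∀ i, 0 < m i) {s : Set ℝ} (hs : IsOpen s)
    (hs' : IsPreconnected s) {x v : ℝ → Config N} (h : SolvesOn α m s x v) :
    ∃ E, ∀ t ∈ s, energy α m (x t) (v t) = E :=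
  hs.exists_is_const_of_deriv_eq_zero hs'
    (fun _ ht => (h.hasDerivAt_energy hm ht).differentiableAt.differentiableWithinAt)
    (fun _ ht => (h.hasDerivAt_energy hm ht).deriv)

/-- The time derivative `2 ∑ m_i ⟪x_i, v_i⟫` of the moment of inertia along a motion. -/
noncomputable def virial (m : Fin N → ℝ) (x v : Config N) : ℝ := ∑ i, m i * (2 * ⟪x i, v i⟫)

theorem SolvesOn.hasDerivAt_inertia {s : Set ℝ} {x v : ℝ → Config N}
    (h : SolvesOn α m s x v) {t : ℝ} (ht : t ∈ s) :
    HasDerivAt (fun t => inertia m (x t)) (virial m (x t) (v t)) t :=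
  HasDerivAt.fun_sum fun i _ => HasDerivAt.const_mul _
    ((hasDerivAt_pi.1 (h.position t ht)) i).norm_sq

/-- The **Lagrange–Jacobi identity** `I'' = 4 E + (2 α - 4) U`. -/
theorem SolvesOn.hasDerivAt_virial (hm : ∀ i, 0 < m i) {s : Set ℝ} {x v : ℝ → Config N}
    (h : SolvesOn α m s x v) {t : ℝ} (ht : t ∈ s) :
    HasDerivAt (fun t => virial m (x t) (v t))
      (4 * energy α m (x t) (v t) + (2 * α - 4) * potential α m (x t)) t := by
  have h1 : HasDerivAt (fun t => virial m (x t) (v t))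
      (∑ i, m i * (2 * (⟪x t i, acceleration α m (x t) i⟫ + ⟪v t i, v t i⟫))) t :=
    HasDerivAt.fun_sum fun i _ => HasDerivAt.const_mul _ (HasDerivAt.const_mul _
      (((hasDerivAt_pi.1 (h.position t ht)) i).inner ℝ ((hasDerivAt_pi.1 (h.velocity t ht)) i)))
  refine h1.congr_deriv ?_
  have h2 : ∀ i, m i * (2 * (⟪x t i, acceleration α m (x t) i⟫ + ⟪v t i, v t i⟫))
      = 2 * ⟪force α m (x t) i, x t i⟫ + 2 * (m i * ‖v t i‖ ^ 2) := by
    intro i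
    rw [← smul_acceleration hm, real_inner_smul_left, real_inner_comm (x t i),
      real_inner_self_eq_norm_sq]
    ring
  simp_rw [h2]
  rw [Finset.sum_add_distrib, ← Finset.mul_sum, ← Finset.mul_sum,
    sum_inner_force_self (h.notMem t ht), energy]
  ring

theorem norm_sq_le_of_energy (hm : ∀ i, 0 < m i) (x v : Config N) (i : Fin N) :
    m i * ‖v i‖ ^ 2 ≤ 2 * (energy α m x v - potential α m x) := by
  have : m i * ‖v i‖ ^ 2 ≤ ∑ i, m i * ‖v i‖ ^ 2 :=
    Finset.single_le_sum (f := fun i => m i * ‖v i‖ ^ 2)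
      (fun i _ => mul_nonneg (hm i).le (sq_nonneg _)) (Finset.mem_univ i)
  rw [energy]; linarith

theorem continuous_inertia (m : Fin N → ℝ) : Continuous (inertia m) := by
  unfold inertia; fun_prop

theorem inertia_nonneg (hm : ∀ i, 0 < m i) (x : Config N) : 0 ≤ inertia m x :=
  Finset.sum_nonneg fun i _ => mul_nonneg (hm i).le (sq_nonneg _)

theorem exists_norm_le_of_energy (hm : ∀ i, 0 < m i) (E R : ℝ) :
    ∃ V, 0 ≤ V ∧ ∀ x v : Config N, energy α m x v ≤ E → -potential α m x ≤ R → ‖v‖ ≤ V := by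
  refine ⟨∑ i, √(2 * (E + R) / m i), Finset.sum_nonneg fun i _ => Real.sqrt_nonneg _, ?_⟩
  intro x v hE hR
  refine (pi_norm_le_iff_of_nonneg (Finset.sum_nonneg fun i _ => Real.sqrt_nonneg _)).2 fun i => ?_
  refine le_trans ?_ (Finset.single_le_sum (f := fun i => √(2 * (E + R) / m i))
    (fun i _ => Real.sqrt_nonneg _) (Finset.mem_univ i))
  refine Real.le_sqrt_of_sq_le ?_
  rw [le_div_iff₀ (hm i)]
  have := norm_sq_le_of_energy (α := α) hm x v i
  linarith

theorem exists_separation_of_potential (hα : 0 < α) (hm : ∀ i, 0 < m i) (R : ℝ) :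
    ∃ δ, 0 < δ ∧ ∀ x : Config N, x ∉ collisionSet N → -potential α m x ≤ R →
      ∀ i j, i < j → δ ≤ ‖x i - x j‖ := by
  have hpos : ∀ i j, 0 < (m i * m j / max R 1) ^ α⁻¹ := fun i j =>
    Real.rpow_pos_of_pos (div_pos (mul_pos (hm i) (hm j)) (by positivity)) _
  obtain ⟨δ, hδ, h⟩ : ∃ δ > 0, ∀ p : Fin N × Fin N, δ ≤ (m p.1 * m p.2 / max R 1) ^ α⁻¹ := by
    have := (Finite.exists_le (fun p : Fin N × Fin N =>
      ((m p.1 * m p.2 / max R 1) ^ α⁻¹)⁻¹))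
    obtain ⟨M, hM⟩ := this
    refine ⟨(max M 1)⁻¹, by positivity, fun p => ?_⟩
    rw [inv_le_comm₀ (by positivity) (hpos p.1 p.2)]
    exact (hM p).trans (le_max_left _ _)
  refine ⟨δ, hδ, fun x hx hR i j hij => (h (i, j)).trans ?_⟩
  have hn : 0 < ‖x i - x j‖ :=
    norm_pos_iff.2 (sub_ne_zero.2 (ne_of_notMem_collisionSet hx hij.ne))
  have h1 := (term_le_neg_potential (α := α) hm x hij).trans (hR.trans (le_max_left R 1))
  rw [Real.rpow_inv_le_iff_of_pos (div_pos (mul_pos (hm i) (hm j)) (by positivity)).le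
    hn.le hα, div_le_iff₀ (by positivity)]
  rw [div_le_iff₀ (Real.rpow_pos_of_pos hn α)] at h1
  linarith

theorem exists_neg_potential_le (hα : 0 < α) (hm : ∀ i, 0 < m i) {δ : ℝ} (hδ : 0 < δ) :
    ∃ R, ∀ x : Config N, (∀ i j, i < j → δ ≤ ‖x i - x j‖) → -potential α m x ≤ R := by
  refine ⟨∑ i, ∑ j with i < j, m i * m j / δ ^ α, fun x hx => ?_⟩
  rw [potential, neg_neg]
  refine Finset.sum_le_sum fun i _ => Finset.sum_le_sum fun j hj => ?_
  have := hm i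
  have := hm j
  have := hx i j (by simpa using hj)
  gcongr

/-! ### The potential is unbounded at a singularity -/

/-- A solution whose positions and velocities converge to a collision-free state can be extended,
by gluing to it the local solution that starts from the limit state. -/
theorem not_isMaximalSolution_of_tendsto (hm : ∀ i, 0 < m i) {T : ℝ} {x v : ℝ → Config N}
    {q w : Config N} (hq : q ∉ collisionSet N) (hx : Tendsto x (𝓝[<] T) (𝓝 q))
    (hv : Tendsto v (𝓝[<] T) (𝓝 w)) : ¬ IsMaximalSolution α m T x v := by
  intro hmax
  have hT : 0 < T := by exact_mod_cast hmax.pos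
  have hsol : SolvesOn α m (Ioo 0 T) x v :=
    (hmax.isSolution.solvesOn hm).mono fun t ht => ⟨ht.1, by exact_mod_cast ht.2⟩
  have hF : ContDiffAt ℝ 1 (fun p : Config N × Config N => (p.2, acceleration α m p.1)) (q, w) :=
    contDiffAt_snd.prodMk
      (ContDiffAt.comp (q, w) (g := acceleration α m) (contDiffAt_acceleration hq) contDiffAt_fst)
  obtain ⟨γ, hγT, ε₁, hε₁, hγ⟩ :=
    hF.exists_forall_mem_closedBall_exists_eq_forall_mem_Ioo_hasDerivAt₀ T
  have hγfst : ∀ t ∈ Ioo (T - ε₁) (T + ε₁), HasDerivAt (fun t => (γ t).1) (γ t).2 t := fun t ht =>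
    (hasFDerivAt_fst (p := γ t)).comp_hasDerivAt t (hγ t ht)
  have hγsnd : ∀ t ∈ Ioo (T - ε₁) (T + ε₁),
      HasDerivAt (fun t => (γ t).2) (acceleration α m (γ t).1) t := fun t ht =>
    (hasFDerivAt_snd (p := γ t)).comp_hasDerivAt t (hγ t ht)
  have hTmem : T ∈ Ioo (T - ε₁) (T + ε₁) := ⟨by linarith, by linarith⟩
  have hγ1 : (γ T).1 = q := by rw [hγT]
  have hγ2 : (γ T).2 = w := by rw [hγT]
  obtain ⟨ε₂, hε₂, hncol⟩ : ∃ ε₂ > 0, ∀ t ∈ Ioo (T - ε₂) (T + ε₂), (γ t).1 ∉ collisionSet N := by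
    have hc : ContinuousAt (fun t => (γ t).1) T := (hγfst T hTmem).continuousAt
    have := hc.eventually_mem ((isClosed_collisionSet N).isOpen_compl.mem_nhds
      (show (γ T).1 ∈ (collisionSet N)ᶜ by rwa [hγ1]))
    obtain ⟨ε₂, hε₂, h⟩ := Metric.eventually_nhds_iff_ball.1 this
    exact ⟨ε₂, hε₂, fun t ht => h t (by rwa [Real.ball_eq_Ioo])⟩
  set ε := min ε₁ ε₂ with hε
  have hεpos : 0 < ε := lt_min hε₁ hε₂
  set y : ℝ → Config N := fun t => if t < T then x t else (γ t).1 with hy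
  set u : ℝ → Config N := fun t => if t < T then v t else (γ t).2 with hu
  have hyu : IsSolutionOn α m ((T + ε : ℝ) : EReal) y u := by
    have hlt : ∀ t < T, y =ᶠ[𝓝 t] x ∧ u =ᶠ[𝓝 t] v := fun t ht =>
      ⟨by filter_upwards [eventually_lt_nhds ht] with s hs using if_pos hs,
        by filter_upwards [eventually_lt_nhds ht] with s hs using if_pos hs⟩
    have hset : ∀ t < T, (timeInterval ((T + ε : ℝ) : EReal) : Set ℝ) =ᶠ[𝓝 t]
        timeInterval (T : EReal) := by
      intro t ht
      filter_upwards [eventually_lt_nhds ht] with s hs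
      have h2 : s < T + ε := by linarith
      exact propext ⟨fun h => ⟨h.1, by exact_mod_cast hs⟩, fun h => ⟨h.1, by exact_mod_cast h2⟩⟩
    have hge : ∀ t, T < t → y =ᶠ[𝓝 t] (fun t => (γ t).1) ∧ u =ᶠ[𝓝 t] (fun t => (γ t).2) :=
      fun t ht => ⟨by filter_upwards [eventually_gt_nhds ht] with s hs using if_neg hs.not_gt,
        by filter_upwards [eventually_gt_nhds ht] with s hs using if_neg hs.not_gt⟩
    have hbound : ∀ t ∈ timeInterval ((T + ε : ℝ) : EReal), 0 ≤ t ∧ t < T + ε :=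
      fun t ht => ⟨ht.1, by exact_mod_cast ht.2⟩
    have hmem₁ : ∀ t, T ≤ t → t < T + ε → t ∈ Ioo (T - ε₁) (T + ε₁) := fun t h1 h2 =>
      ⟨by linarith, by linarith [min_le_left ε₁ ε₂]⟩
    have hmem₂ : ∀ t, T ≤ t → t < T + ε → t ∈ Ioo (T - ε₂) (T + ε₂) := fun t h1 h2 =>
      ⟨by linarith, by linarith [min_le_right ε₁ ε₂]⟩
    have hold : ∀ t, 0 ≤ t → t < T → t ∈ timeInterval (T : EReal) := fun t h1 h2 =>
      ⟨h1, by exact_mod_cast h2⟩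
    refine ⟨fun t ht => ?_, fun t ht => ?_, fun t ht => ?_⟩
    · obtain ⟨h0, hτ⟩ := hbound t ht
      rcases lt_or_ge t T with h | h
      · rw [show y t = x t from if_pos h]
        exact hmax.isSolution.noCollision t (hold t h0 h)
      · rw [show y t = (γ t).1 from if_neg h.not_gt]
        exact hncol t (hmem₂ t h hτ)
    · obtain ⟨h0, hτ⟩ := hbound t ht
      rcases lt_trichotomy t T with h | h | h
      · rw [show u t = v t from if_pos h, hasDerivWithinAt_congr_set (hset t h)]
        exact (hmax.isSolution.hasDeriv_position t (hold t h0 h)).congr_of_eventuallyEq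
          ((hlt t h).1.filter_mono nhdsWithin_le_nhds) (if_pos h)
      · subst h
        rw [show u t = (γ t).2 from if_neg (lt_irrefl t)]
        exact (hasDerivAt_ite_lt hT hsol.position (by rwa [hγ1]) (by rwa [hγ2])
          (hγfst t hTmem)).hasDerivWithinAt
      · rw [show u t = (γ t).2 from if_neg h.not_gt]
        exact ((hγfst t (hmem₁ t h.le hτ)).congr_of_eventuallyEq (hge t h).1).hasDerivWithinAt
    · obtain ⟨h0, hτ⟩ := hbound t ht
      rcases lt_trichotomy t T with h | h | h
      · rw [show y t = x t from if_pos h]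
        obtain ⟨a, ha, hf⟩ := hmax.isSolution.hasDeriv_velocity t (hold t h0 h)
        refine ⟨a, ?_, hf⟩
        rw [hasDerivWithinAt_congr_set (hset t h)]
        exact ha.congr_of_eventuallyEq ((hlt t h).2.filter_mono nhdsWithin_le_nhds) (if_pos h)
      · subst h
        rw [show y t = (γ t).1 from if_neg (lt_irrefl t)]
        refine ⟨acceleration α m (γ t).1, ?_, smul_acceleration hm _⟩
        refine (hasDerivAt_ite_lt hT hsol.velocity (by rwa [hγ2]) ?_
          (hγsnd t hTmem)).hasDerivWithinAt
        rw [hγ1]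
        exact ((contDiffAt_acceleration hq).continuousAt.tendsto).comp hx
      · rw [show y t = (γ t).1 from if_neg h.not_gt]
        exact ⟨acceleration α m (γ t).1, ((hγsnd t (hmem₁ t h.le hτ)).congr_of_eventuallyEq
          (hge t h).2).hasDerivWithinAt, smul_acceleration hm _⟩
  have hle := hmax.maximal _ y u hyu fun t ht => if_pos (by exact_mod_cast ht.2)
  have : T + ε ≤ T := by exact_mod_cast hle
  linarith

theorem SolvesOn.exists_tendsto_of_separated (hα : 0 < α) (hm : ∀ i, 0 < m i) {s T δ E : ℝ}
    (hs : s < T) {x v : ℝ → Config N} (h : SolvesOn α m (Ioo s T) x v) (hδ : 0 < δ)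
    (hE : ∀ t ∈ Ioo s T, energy α m (x t) (v t) = E)
    (hsep : ∀ t ∈ Ioo s T, ∀ i j, i < j → δ ≤ ‖x t i - x t j‖) :
    ∃ q w, q ∉ collisionSet N ∧ Tendsto x (𝓝[<] T) (𝓝 q) ∧ Tendsto v (𝓝[<] T) (𝓝 w) := by
  obtain ⟨R, hR⟩ := exists_neg_potential_le hα hm hδ
  obtain ⟨V, -, hV⟩ := exists_norm_le_of_energy (α := α) hm E R
  obtain ⟨q, hq⟩ := exists_tendsto_of_deriv_bounded hs h.position
    fun t ht => hV _ _ (hE t ht).le (hR _ (hsep t ht))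
  have hqΔ : q ∉ collisionSet N := by
    rintro ⟨i, j, hij, hqij⟩
    have hlim : Tendsto (fun t => ‖x t i - x t j‖) (𝓝[<] T) (𝓝 ‖q i - q j‖) :=
      ((tendsto_pi_nhds.1 hq i).sub (tendsto_pi_nhds.1 hq j)).norm
    have := ge_of_tendsto hlim (by
      filter_upwards [Ioo_mem_nhdsLT hs] with t ht using hsep t ht i j hij)
    rw [hqij, sub_self, norm_zero] at this
    linarith
  have hacc : Tendsto (fun t => ‖acceleration α m (x t)‖) (𝓝[<] T) (𝓝 ‖acceleration α m q‖) :=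
    (((contDiffAt_acceleration hqΔ).continuousAt.tendsto).comp hq).norm
  obtain ⟨s', hs', hsub⟩ := mem_nhdsLT_iff_exists_Ioo_subset.1
    ((hacc.eventually (eventually_le_nhds (lt_add_one _))).and
      (Ioo_mem_nhdsLT hs))
  obtain ⟨w, hw⟩ := exists_tendsto_of_deriv_bounded hs' (fun t ht => h.velocity t (hsub ht).2)
    fun t ht => (hsub ht).1
  exact ⟨q, w, hqΔ, hq, hw⟩

/-- **Painlevé's theorem**: at a singularity the potential tends to `-∞`. -/
theorem IsMaximalSolution.tendsto_potential (hα : 0 < α) (hm : ∀ i, 0 < m i) {T : ℝ}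
    {x v : ℝ → Config N} (hmax : IsMaximalSolution α m T x v) :
    Tendsto (fun t => potential α m (x t)) (𝓝[<] T) atBot := by
  have hT : 0 < T := by exact_mod_cast hmax.pos
  have hsol : SolvesOn α m (Ioo 0 T) x v :=
    (hmax.isSolution.solvesOn hm).mono fun t ht => ⟨ht.1, by exact_mod_cast ht.2⟩
  obtain ⟨E, hE⟩ := hsol.exists_energy_eq hm isOpen_Ioo isPreconnected_Ioo
  by_contra hcon
  obtain ⟨R, hR⟩ : ∃ R, ∃ᶠ t in 𝓝[<] T, -potential α m (x t) ≤ R := by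
    rw [tendsto_atBot] at hcon
    push Not at hcon
    obtain ⟨b, hb⟩ := hcon
    exact ⟨-b, hb.mono fun t ht => by linarith⟩
  obtain ⟨δ, hδ, hsep⟩ := exists_separation_of_potential hα hm R
  obtain ⟨R', hR'⟩ := exists_neg_potential_le hα hm (half_pos hδ)
  obtain ⟨V, hV0, hV⟩ := exists_norm_le_of_energy (α := α) hm E R'
  have hV1 : 0 < V + 1 := by linarith
  have hnear : max 0 (T - δ / (4 * (V + 1))) < T :=
    max_lt hT (sub_lt_self _ (by positivity))
  obtain ⟨s, hsR, hs⟩ := (hR.and_eventually (Ioo_mem_nhdsLT hnear)).exists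
  have hs0 : 0 < s := (le_max_left _ _).trans_lt hs.1
  have hsT : (V + 1) * (T - s) ≤ δ / 4 := by
    have h1 : T - s ≤ δ / (4 * (V + 1)) := by
      linarith [(le_max_right 0 (T - δ / (4 * (V + 1)))).trans_lt hs.1]
    calc (V + 1) * (T - s) ≤ (V + 1) * (δ / (4 * (V + 1))) := by gcongr
      _ = δ / 4 := by field_simp
  have hclose : ∀ t, ‖x t - x s‖ ≤ δ / 4 → ∀ i j, i < j → δ / 2 ≤ ‖x t i - x t j‖ := by
    intro t ht i j hij
    have h1 := hsep (x s) (hsol.notMem s ⟨hs0, hs.2⟩) hsR i j hij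
    have h2 := (norm_le_pi_norm (x t - x s) i).trans ht
    have h3 := (norm_le_pi_norm (x t - x s) j).trans ht
    have h4 : x s i - x s j = (x t i - x t j) - (x t - x s) i + (x t - x s) j := by
      simp only [Pi.sub_apply]; abel
    have h5 := norm_add_le ((x t i - x t j) - (x t - x s) i) ((x t - x s) j)
    have h6 := norm_sub_le (x t i - x t j) ((x t - x s) i)
    rw [← h4] at h5
    linarith
  -- As long as the displacement from `x s` is at most `δ / 4`, the speed is at most `V`, and the
  -- time left is too short for the displacement to reach `δ / 4` at speed `V + 1`.
  have hbarrier : ∀ t ∈ Ioo s T, ‖x t - x s‖ ≤ δ / 4 := by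
    intro t ht
    have hmem : ∀ u ∈ Icc s t, u ∈ Ioo 0 T := fun u hu =>
      ⟨hs0.trans_le hu.1, hu.2.trans_lt ht.2⟩
    have h1 := image_norm_le_of_norm_deriv_right_lt_deriv_boundary
      (f := fun u => x u - x s) (f' := v) (B := fun u => (V + 1) * (u - s)) (B' := fun _ => V + 1)
      (a := s) (b := t)
      (fun u hu => ((hsol.position u (hmem u hu)).sub_const _).continuousAt.continuousWithinAt)
      (fun u hu =>
        ((hsol.position u (hmem u (Ico_subset_Icc_self hu))).sub_const _).hasDerivWithinAt)
      (by simp) (fun u => by simpa using ((hasDerivAt_id u).sub_const s).const_mul (V + 1))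
      (fun u hu hnorm => by
        have hu' := hmem u (Ico_subset_Icc_self hu)
        have h2 : ‖x u - x s‖ ≤ δ / 4 := by
          rw [hnorm]
          refine le_trans ?_ hsT
          have := hu'.2
          gcongr
        have := hV _ _ (hE u hu').le (hR' _ (hclose u h2))
        linarith) (right_mem_Icc.2 ht.1.le)
    refine h1.trans (le_trans ?_ hsT)
    have := ht.2
    gcongr
  have hsub : Ioo s T ⊆ Ioo 0 T := Ioo_subset_Ioo_left hs0.le
  obtain ⟨q, w, hq, hxq, hvw⟩ := (hsol.mono hsub).exists_tendsto_of_separated hα hm hs.2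
    (half_pos hδ) (fun t ht => hE t (hsub ht)) fun t ht => hclose t (hbarrier t ht)
  exact not_isMaximalSolution_of_tendsto hm hq hxq hvw hmax

/-! ### Centres of mass of clusters -/

/-- The Euclidean space `(ℝ³)^N` in which mass-scaled configurations live. It is a definition of
its own so that its topology and module structure are found through the norm only. -/
def ScaledSpace (N : ℕ) : Type := PiLp 2 fun _ : Fin N => Space

noncomputable instance : NormedAddCommGroup (ScaledSpace N) :=
  inferInstanceAs (NormedAddCommGroup (PiLp 2 fun _ : Fin N => Space))

noncomputable instance : InnerProductSpace ℝ (ScaledSpace N) :=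
  inferInstanceAs (InnerProductSpace ℝ (PiLp 2 fun _ : Fin N => Space))

instance : FiniteDimensional ℝ (ScaledSpace N) :=
  inferInstanceAs (FiniteDimensional ℝ (PiLp 2 fun _ : Fin N => Space))

/-- The map `x ↦ (√m_i x_i)_i` into the Euclidean space `(ℝ³)^N`, which turns the mass-weighted
scalar product `∑ m_i ⟪x_i, y_i⟫` into the standard one. -/
noncomputable def massScale (m : Fin N → ℝ) : Config N →L[ℝ] ScaledSpace N :=
  LinearMap.toContinuousLinearMap
    { toFun := fun x => WithLp.toLp 2 fun i => √(m i) • x i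
      map_add' := fun x y => congrArg (WithLp.toLp 2) (funext fun i => smul_add _ (x i) (y i))
      map_smul' := fun c x => congrArg (WithLp.toLp 2) (funext fun i => smul_comm _ c (x i)) }

theorem massScale_eq (m : Fin N → ℝ) (x : Config N) :
    massScale m x = (WithLp.toLp 2 fun i => √(m i) • x i : PiLp 2 fun _ : Fin N => Space) := rfl

theorem inner_massScale (hm : ∀ i, 0 < m i) (x y : Config N) :
    ⟪massScale m x, massScale m y⟫ = ∑ i, m i * ⟪x i, y i⟫ := by
  rw [massScale_eq, massScale_eq]
  refine (PiLp.inner_apply _ _).trans (Finset.sum_congr rfl fun i _ => ?_)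
  rw [real_inner_smul_left, real_inner_smul_right, ← mul_assoc, Real.mul_self_sqrt (hm i).le]

theorem norm_sq_massScale (hm : ∀ i, 0 < m i) (x : Config N) :
    ‖massScale m x‖ ^ 2 = inertia m x := by
  rw [← real_inner_self_eq_norm_sq, inner_massScale hm, inertia]
  simp_rw [real_inner_self_eq_norm_sq]

theorem exists_norm_le_massScale (hm : ∀ i, 0 < m i) :
    ∃ κ, 0 < κ ∧ ∀ x : Config N, κ * ‖x‖ ≤ ‖massScale m x‖ := by
  have hker : LinearMap.ker (massScale m).toLinearMap = ⊥ := by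
    rw [LinearMap.ker_eq_bot']
    intro x hx
    have h0 : inertia m x = 0 := by
      rw [← norm_sq_massScale hm, show massScale m x = 0 from hx, norm_zero, sq, zero_mul]
    funext i
    have h1 := (Finset.sum_eq_zero_iff_of_nonneg
      fun i _ => mul_nonneg (hm i).le (sq_nonneg ‖x i‖)).1 h0 i (Finset.mem_univ i)
    simpa [(hm i).ne'] using h1
  obtain ⟨K, hK, h⟩ := (massScale m).toLinearMap.exists_antilipschitzWith hker
  refine ⟨(K : ℝ)⁻¹, by positivity, fun x => ?_⟩
  rw [inv_mul_le_iff₀ (by positivity)]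
  simpa using h.le_mul_norm_sub x 0

/-- The configurations in which particles at the same place in `q` are again at the same place,
seen in the mass-scaled Euclidean space. Its orthogonal projection replaces every particle of a
cluster of `q` by the centre of mass of the cluster. -/
noncomputable def clusterSpace (m : Fin N → ℝ) (q : Config N) :
    Submodule ℝ (ScaledSpace N) :=
  Submodule.map (massScale m).toLinearMap
    { carrier := {y | ∀ i j, q i = q j → y i = y j}
      add_mem' := fun ha hb i j h => by rw [Pi.add_apply, Pi.add_apply, ha i j h, hb i j h]
      zero_mem' := fun _ _ _ => rfl
      smul_mem' := fun c y hy i j h => by rw [Pi.smul_apply, Pi.smul_apply, hy i j h] }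

theorem mem_clusterSpace {q : Config N} {z : ScaledSpace N} :
    z ∈ clusterSpace m q ↔ ∃ y : Config N, (∀ i j, q i = q j → y i = y j) ∧ massScale m y = z :=
  Iff.rfl

theorem massScale_mem_clusterSpace (q : Config N) : massScale m q ∈ clusterSpace m q :=
  mem_clusterSpace.2 ⟨q, fun _ _ h => h, rfl⟩

/-- The centres of mass of the clusters of `q`, for particles at `x`: every particle of a cluster
is moved to the centre of mass of the cluster, in mass-scaled coordinates. -/
noncomputable def clusterCenter (m : Fin N → ℝ) (q : Config N) :
    Config N →L[ℝ] ScaledSpace N :=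
  (clusterSpace m q).starProjection ∘L massScale m

theorem clusterCenter_apply (q x : Config N) :
    clusterCenter m q x = (clusterSpace m q).starProjection (massScale m x) := rfl

theorem clusterCenter_self (q : Config N) : clusterCenter m q q = massScale m q :=
  Submodule.starProjection_eq_self_iff.2 (massScale_mem_clusterSpace q)

theorem norm_clusterCenter_le (q x : Config N) : ‖clusterCenter m q x‖ ≤ ‖massScale m x‖ :=
  Submodule.norm_starProjection_apply_le _ _

/-- The moment of inertia of the clusters of `q` about their centres of mass. -/
noncomputable def clusterInertia (m : Fin N → ℝ) (q x : Config N) : ℝ :=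
  inertia m x - ‖clusterCenter m q x‖ ^ 2

theorem clusterInertia_eq (hm : ∀ i, 0 < m i) (q x : Config N) :
    clusterInertia m q x = ‖massScale m x - clusterCenter m q x‖ ^ 2 := by
  have h1 : ⟪massScale m x - clusterCenter m q x, clusterCenter m q x⟫ = 0 :=
    Submodule.starProjection_inner_eq_zero _ _ (Submodule.starProjection_apply_mem _ _)
  have h2 := norm_add_sq_real (massScale m x - clusterCenter m q x) (clusterCenter m q x)
  rw [sub_add_cancel, h1, norm_sq_massScale hm] at h2
  rw [clusterInertia]
  linarith

theorem clusterInertia_nonneg (hm : ∀ i, 0 < m i) (q x : Config N) :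
    0 ≤ clusterInertia m q x := by
  rw [clusterInertia_eq hm]; positivity

theorem clusterInertia_le (hm : ∀ i, 0 < m i) (q x : Config N) :
    clusterInertia m q x ≤ ‖massScale m (x - q)‖ ^ 2 := by
  have h : clusterInertia m q x = clusterInertia m q (x - q) := by
    rw [clusterInertia_eq hm, clusterInertia_eq hm, map_sub, map_sub, clusterCenter_self,
      sub_sub_sub_cancel_right]
  rw [h, clusterInertia, ← norm_sq_massScale hm]
  linarith [sq_nonneg ‖clusterCenter m q (x - q)‖]

/-- If `x` is far from `q` while its clusters are tight, then the centres of the clusters of `x` are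
far from those of a configuration `y` close to `q`. -/
theorem le_norm_clusterCenter_sub (hm : ∀ i, 0 < m i) {q x y : Config N} {d : ℝ} (hd : 0 ≤ d)
    (hx : 10 * d ≤ ‖massScale m (x - q)‖) (hJ : clusterInertia m q x ≤ d ^ 2)
    (hy : ‖massScale m (y - q)‖ ≤ d) :
    64 * d ^ 2 ≤ ‖clusterCenter m q x - clusterCenter m q y‖ ^ 2 := by
  have h2 : ‖massScale m x - clusterCenter m q x‖ ≤ d := by
    rw [clusterInertia_eq hm] at hJ
    exact le_of_sq_le_sq hJ hd
  have h3 : ‖clusterCenter m q (y - q)‖ ≤ d := (norm_clusterCenter_le q _).trans hy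
  have h4 : massScale m (x - q) = (massScale m x - clusterCenter m q x)
      + (clusterCenter m q x - clusterCenter m q y) + clusterCenter m q (y - q) := by
    rw [map_sub, map_sub, clusterCenter_self]; abel
  have h5 := norm_add₃_le (a := massScale m x - clusterCenter m q x)
    (b := clusterCenter m q x - clusterCenter m q y) (c := clusterCenter m q (y - q))
  rw [← h4] at h5
  have h7 : 8 * d ≤ ‖clusterCenter m q x - clusterCenter m q y‖ := by linarith
  calc 64 * d ^ 2 = (8 * d) ^ 2 := by ring
    _ ≤ _ := by gcongr

/-- Near `q` the centres of mass of the clusters of `q` have bounded acceleration: the forces inside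
a cluster cancel, and the distances between clusters are bounded below. -/
theorem exists_norm_clusterCenter_acceleration_le (hα : 0 < α) (hm : ∀ i, 0 < m i) (q : Config N) :
    ∃ r C, 0 < r ∧ 0 ≤ C ∧ ∀ x : Config N, ‖x - q‖ ≤ r →
      ‖clusterCenter m q (acceleration α m x)‖ ≤ C := by
  obtain ⟨κ, hκ, hκle⟩ := exists_norm_le_massScale hm
  -- `g` collects the sizes of the forces between different clusters only.
  set g : Config N → ℝ := fun x => ∑ i, ∑ j with i < j,
    if q i = q j then 0 else m i * m j / ‖x i - x j‖ ^ (α + 2) * ‖x i - x j‖ with hg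
  have hg0 : ∀ x, 0 ≤ g x := fun x => Finset.sum_nonneg fun i _ => Finset.sum_nonneg fun j _ => by
    have := hm i; have := hm j
    split_ifs <;> positivity
  have hgc : ContinuousAt g q := by
    refine tendsto_finsetSum _ fun i _ => tendsto_finsetSum _ fun j _ => ?_
    by_cases hij : q i = q j
    · simpa only [hij, if_true] using tendsto_const_nhds
    · simp only [hij, if_false]
      have hpos : 0 < ‖q i - q j‖ := norm_pos_iff.2 (sub_ne_zero.2 hij)
      have hd : ContinuousAt (fun y : Config N => ‖y i - y j‖) q := by fun_prop
      exact (ContinuousAt.div continuousAt_const (hd.rpow_const (Or.inl hpos.ne'))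
        (Real.rpow_pos_of_pos hpos _).ne').mul hd
  obtain ⟨r, hr, hball⟩ := Metric.nhds_basis_closedBall.eventually_iff.1
    (hgc.eventually (eventually_le_nhds (lt_add_one (g q))))
  have hC : 0 ≤ α * ((g q + 1) * (2 * κ⁻¹)) := by have := hg0 q; positivity
  refine ⟨r, α * ((g q + 1) * (2 * κ⁻¹)), hr, hC, fun x hx => ?_⟩
  set P := clusterCenter m q (acceleration α m x) with hP
  obtain ⟨y, hy, hyP⟩ := mem_clusterSpace.1
    (Submodule.starProjection_apply_mem (clusterSpace m q) (massScale m (acceleration α m x)))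
  rw [← clusterCenter_apply, ← hP] at hyP
  have hsq : ‖P‖ ^ 2 = ∑ i, ⟪force α m x i, y i⟫ := by
    have h1 : ⟪massScale m (acceleration α m x) - P, P⟫ = 0 :=
      Submodule.starProjection_inner_eq_zero _ _ (Submodule.starProjection_apply_mem _ _)
    rw [inner_sub_left, sub_eq_zero, real_inner_self_eq_norm_sq] at h1
    rw [← h1, ← hyP, inner_massScale hm]
    refine Finset.sum_congr rfl fun i _ => ?_
    rw [← smul_acceleration hm, real_inner_smul_left]
  have hyn : ‖y‖ ≤ κ⁻¹ * ‖P‖ := by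
    rw [← hyP, ← div_eq_inv_mul, le_div_iff₀ hκ, mul_comm]; exact hκle y
  have hbound : -∑ i, ∑ j with i < j,
      m i * m j / ‖x i - x j‖ ^ (α + 2) * ⟪x i - x j, y i - y j⟫ ≤ g x * (2 * ‖y‖) := by
    simp only [hg, Finset.sum_mul, ← Finset.sum_neg_distrib]
    refine Finset.sum_le_sum fun i _ => Finset.sum_le_sum fun j _ => ?_
    by_cases hij : q i = q j
    · simp [hij, hy i j hij]
    · rw [if_neg hij]
      have hin : -⟪x i - x j, y i - y j⟫ ≤ ‖x i - x j‖ * (2 * ‖y‖) := by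
        refine (neg_le_abs _).trans ((abs_real_inner_le_norm _ _).trans ?_)
        have h1 := norm_sub_le (y i) (y j)
        have h2 := norm_le_pi_norm y i
        have h3 := norm_le_pi_norm y j
        gcongr
        linarith
      have hw : 0 ≤ m i * m j / ‖x i - x j‖ ^ (α + 2) := neg_potential_term_nonneg hm x i j
      have := mul_le_mul_of_nonneg_left hin hw
      linarith
  have hfin : ‖P‖ * ‖P‖ ≤ α * ((g q + 1) * (2 * κ⁻¹)) * ‖P‖ := by
    have hgx : g x ≤ g q + 1 := hball (mem_closedBall_iff_norm.2 hx)
    calc ‖P‖ * ‖P‖ = α * -∑ i, ∑ j with i < j,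
          m i * m j / ‖x i - x j‖ ^ (α + 2) * ⟪x i - x j, y i - y j⟫ := by
          rw [← sq, hsq, sum_inner_force, mul_neg]
      _ ≤ α * (g x * (2 * ‖y‖)) := by gcongr
      _ ≤ α * ((g q + 1) * (2 * (κ⁻¹ * ‖P‖))) := by
          have := hg0 q
          gcongr
      _ = _ := by ring
  rcases (norm_nonneg P).eq_or_lt with h | h
  · rw [← h]; exact hC
  · exact le_of_mul_le_mul_right hfin h

theorem SolvesOn.hasDerivAt_clusterCenter {s : Set ℝ} {x v : ℝ → Config N}
    (h : SolvesOn α m s x v) (q : Config N) {t : ℝ} (ht : t ∈ s) :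
    HasDerivAt (fun t => clusterCenter m q (x t)) (clusterCenter m q (v t)) t :=
  (clusterCenter m q).hasFDerivAt.comp_hasDerivAt t (h.position t ht)

theorem SolvesOn.hasDerivAt_clusterCenter_velocity {s : Set ℝ} {x v : ℝ → Config N}
    (h : SolvesOn α m s x v) (q : Config N) {t : ℝ} (ht : t ∈ s) :
    HasDerivAt (fun t => clusterCenter m q (v t)) (clusterCenter m q (acceleration α m (x t))) t :=
  (clusterCenter m q).hasFDerivAt.comp_hasDerivAt t (h.velocity t ht)

/-- The second derivative of the inertia of the clusters is `I'' - 2 ⟪c, c''⟫ - 2 |c'|²`, where `c`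
denotes the cluster centres; it is negative once `I''` is below `-2 R C`. -/
theorem SolvesOn.concaveOn_clusterInertia (hm : ∀ i, 0 < m i) {x v : ℝ → Config N} {a b R C : ℝ}
    (h : SolvesOn α m (Icc a b) x v) {q : Config N} (hR0 : 0 ≤ R)
    (hR : ∀ t ∈ Icc a b, ‖clusterCenter m q (x t)‖ ≤ R)
    (hC : ∀ t ∈ Icc a b, ‖clusterCenter m q (acceleration α m (x t))‖ ≤ C)
    (hneg : ∀ t ∈ Icc a b, 4 * energy α m (x t) (v t) + (2 * α - 4) * potential α m (x t)
      + 2 * (R * C) ≤ 0) :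
    ConcaveOn ℝ (Icc a b) fun t => clusterInertia m q (x t) := by
  have hJd : ∀ u ∈ Icc a b, HasDerivAt (fun t => clusterInertia m q (x t))
      (virial m (x u) (v u) - 2 * ⟪clusterCenter m q (x u), clusterCenter m q (v u)⟫) u :=
    fun u hu => (h.hasDerivAt_inertia hu).sub (h.hasDerivAt_clusterCenter q hu).norm_sq
  refine concaveOn_of_hasDerivWithinAt2_nonpos (convex_Icc a b)
    (fun u hu => (hJd u hu).continuousAt.continuousWithinAt)
    (fun u hu => (hJd u (interior_subset hu)).hasDerivWithinAt)
    (fun u hu => ((h.hasDerivAt_virial hm (interior_subset hu)).sub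
        (((h.hasDerivAt_clusterCenter q (interior_subset hu)).inner ℝ
          (h.hasDerivAt_clusterCenter_velocity q (interior_subset hu))).const_mul
          2)).hasDerivWithinAt) fun u hu => ?_
  have hu' := interior_subset hu
  have h3 : -⟪clusterCenter m q (x u), clusterCenter m q (acceleration α m (x u))⟫ ≤ R * C :=
    (neg_le_abs _).trans ((abs_real_inner_le_norm _ _).trans
      (mul_le_mul (hR u hu') (hC u hu') (norm_nonneg _) hR0))
  have h4 : 0 ≤ ⟪clusterCenter m q (v u), clusterCenter m q (v u)⟫ := real_inner_self_nonneg
  linarith [hneg u hu']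

/-! ### Convergence at a singularity -/

/-- A limit point of the trajectory at a time where the potential tends to `-∞` and the moment of
inertia converges is its limit: the strong-force case of **von Zeipel's theorem**. -/
theorem SolvesOn.tendsto_of_mapClusterPt (hα : 2 < α) (hm : ∀ i, 0 < m i) {T E I : ℝ}
    {x v : ℝ → Config N} (hT : 0 < T) (h : SolvesOn α m (Ioo 0 T) x v)
    (hE : ∀ t ∈ Ioo 0 T, energy α m (x t) (v t) = E)
    (hU : Tendsto (fun t => potential α m (x t)) (𝓝[<] T) atBot)
    (hI : Tendsto (fun t => inertia m (x t)) (𝓝[<] T) (𝓝 I))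
    {q : Config N} (hq : MapClusterPt q (𝓝[<] T) x) : Tendsto x (𝓝[<] T) (𝓝 q) := by
  by_contra hcon
  obtain ⟨κ, hκ, hκle⟩ := exists_norm_le_massScale hm
  obtain ⟨r₁, C, hr₁, hC0, hC⟩ :=
    exists_norm_clusterCenter_acceleration_le (by linarith : 0 < α) hm q
  obtain ⟨r, hr, hrr, hfar⟩ : ∃ r > 0, r ≤ r₁ ∧ ∃ᶠ t in 𝓝[<] T, r ≤ ‖x t - q‖ := by
    rw [Metric.tendsto_nhds] at hcon
    push Not at hcon
    obtain ⟨ε, hε, hfreq⟩ := hcon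
    refine ⟨min ε r₁, lt_min hε hr₁, min_le_right _ _, hfreq.mono fun t ht => ?_⟩
    rw [← dist_eq_norm]
    exact (min_le_left _ _).trans (by simpa using ht)
  have hI0 : 0 ≤ I := ge_of_tendsto' hI fun t => inertia_nonneg hm (x t)
  -- An excursion moves the cluster centres by at least `10 d - d - d = 8 d`, and by less than `4 d`
  -- if their path is nearly straight and near a sphere.
  obtain ⟨d, hd⟩ : ∃ d, 10 * d = κ * r := ⟨κ * r / 10, by ring⟩
  have hdpos : 0 < d := by have := mul_pos hκ hr; linarith
  obtain ⟨R, hR0, hR⟩ : ∃ R, 0 ≤ R ∧ ∀ c, c ^ 2 ≤ I + d ^ 2 → c ≤ R :=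
    ⟨√(I + d ^ 2), Real.sqrt_nonneg _, fun c => Real.le_sqrt_of_sq_le⟩
  have hevI : ∀ᶠ t in 𝓝[<] T, |inertia m (x t) - I| ≤ d ^ 2 := by
    have := (Metric.tendsto_nhds.1 hI) (d ^ 2) (by positivity)
    filter_upwards [this] with t ht using (by simpa [Real.dist_eq] using ht.le)
  have hevU : ∀ᶠ t in 𝓝[<] T, 4 * E + (2 * α - 4) * potential α m (x t) + 2 * (R * C) ≤ 0 := by
    filter_upwards [hU.eventually_le_atBot (-(4 * E + 2 * (R * C)) / (2 * α - 4))] with t ht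
    rw [le_div_iff₀ (by linarith)] at ht
    linarith
  have hcontT : ∀ K : ℝ, Tendsto (fun t => K * (C * (T - t) * (T - t))) (𝓝[<] T) (𝓝 0) := by
    intro K
    have : Continuous fun t => K * (C * (T - t) * (T - t)) := by fun_prop
    simpa using (this.tendsto T).mono_left nhdsWithin_le_nhds
  have hev1 : ∀ᶠ t in 𝓝[<] T, 1 * (C * (T - t) * (T - t)) ≤ 1 :=
    (hcontT 1).eventually (eventually_le_nhds one_pos)
  have hev2 : ∀ᶠ t in 𝓝[<] T, (4 * R + 1) * (C * (T - t) * (T - t)) ≤ d ^ 2 :=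
    (hcontT (4 * R + 1)).eventually (eventually_le_nhds (by positivity))
  obtain ⟨s₀, hs₀T, hs₀⟩ := mem_nhdsLT_iff_exists_Ioo_subset.1
    (hevI.and (hevU.and (hev1.and (hev2.and (Ioo_mem_nhdsLT hT)))))
  have hsub : Ioo s₀ T ⊆ Ioo 0 T := fun t ht => (hs₀ ht).2.2.2.2
  have hup : ∀ t ∈ Ioo s₀ T, ‖clusterCenter m q (x t)‖ ^ 2 ≤ I + d ^ 2 := by
    intro t ht
    have h1 := (abs_le.1 (hs₀ ht).1).2
    have h2 := clusterInertia_nonneg hm q (x t)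
    rw [clusterInertia] at h2
    linarith
  -- While the clusters stay tight, their centres cannot travel far.
  have hshort : ∀ p p', s₀ < p → p ≤ p' → p' < T → (∀ t ∈ Icc p p', ‖x t - q‖ ≤ r) →
      (∀ t ∈ Icc p p', clusterInertia m q (x t) ≤ d ^ 2) →
      ‖clusterCenter m q (x p) - clusterCenter m q (x p')‖ ^ 2 ≤ 13 * d ^ 2 := by
    intro p p' hp hpp hp' hnear hJle
    have hmem : ∀ t ∈ Icc p p', t ∈ Ioo s₀ T := fun t ht =>
      ⟨hp.trans_le ht.1, ht.2.trans_lt hp'⟩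
    obtain ⟨-, -, hs1, hs2, -⟩ := hs₀ (hmem p (left_mem_Icc.2 hpp))
    have hle : C * (p' - p) * (p' - p) ≤ C * (T - p) * (T - p) := by
      have h1 : 0 ≤ p' - p := by linarith
      have h2 : p' - p ≤ T - p := by linarith
      gcongr
      exact mul_nonneg hC0 (h1.trans h2)
    refine norm_sub_sq_le_of_nearly_straight (c := fun t => clusterCenter m q (x t)) hpp
      (fun t ht => h.hasDerivAt_clusterCenter q (hsub (hmem t ht)))
      (fun t ht => h.hasDerivAt_clusterCenter_velocity q (hsub (hmem t ht))) hC0 hR0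
      (fun t ht => hC (x t) ((hnear t ht).trans hrr))
      (fun t ht => hR _ (hup t (hmem t ht))) (fun t ht => hup t (hmem t ht)) (fun t ht => ?_)
      (by linarith) ((mul_le_mul_of_nonneg_left hle (by positivity)).trans hs2)
    have h1 := (abs_le.1 (hs₀ (hmem t ht)).1).1
    have h2 := hJle t ht
    rw [clusterInertia] at h2
    linarith
  have hlong : ∀ e t, ‖x e - q‖ = r → clusterInertia m q (x e) ≤ d ^ 2 →
      ‖massScale m (x t - q)‖ ≤ d →
      64 * d ^ 2 ≤ ‖clusterCenter m q (x e) - clusterCenter m q (x t)‖ ^ 2 := fun e t he hJe ht =>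
    le_norm_clusterCenter_sub hm hdpos.le (by rw [hd, ← he]; exact hκle _) hJe ht
  -- A time near `q` between two times far from `q`, and the excursion `[a, b]` around it.
  obtain ⟨s₁, hs₁far, hs₁⟩ := (hfar.and_eventually (Ioo_mem_nhdsLT hs₀T)).exists
  have hclose : ∃ᶠ t in 𝓝[<] T, ‖x t - q‖ < r ∧ ‖massScale m (x t - q)‖ ≤ d := by
    refine hq.frequently (p := fun y => ‖y - q‖ < r ∧ ‖massScale m (y - q)‖ ≤ d) ?_
    have h1 : Continuous fun y : Config N => ‖y - q‖ := by fun_prop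
    have h2 : Continuous fun y : Config N => ‖massScale m (y - q)‖ := by fun_prop
    have h1' := h1.tendsto q
    have h2' := h2.tendsto q
    simp only [sub_self, map_zero, norm_zero] at h1' h2'
    exact (h1'.eventually (eventually_lt_nhds hr)).and
      (h2'.eventually (eventually_le_nhds hdpos))
  obtain ⟨t, ⟨htr, htd⟩, ht⟩ := (hclose.and_eventually (Ioo_mem_nhdsLT hs₁.2)).exists
  obtain ⟨s₂, hs₂far, hs₂⟩ := (hfar.and_eventually (Ioo_mem_nhdsLT ht.2)).exists
  have hcont : ∀ a b, s₀ < a → b < T → ContinuousOn (fun t => ‖x t - q‖) (Icc a b) :=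
    fun a b ha hb u hu =>
      (((h.position u (hsub ⟨ha.trans_le hu.1, hu.2.trans_lt hb⟩)).continuousAt.sub
        continuousAt_const).norm).continuousWithinAt
  obtain ⟨b, hb, hbr, hbnear⟩ := exists_first_hit (f := fun t => ‖x t - q‖) hs₂.1.le
    (hcont t s₂ (hs₁.1.trans ht.1) hs₂.2) htr hs₂far
  obtain ⟨a, ha, har, hanear⟩ := exists_last_hit (f := fun t => ‖x t - q‖) ht.1.le
    (hcont s₁ t hs₁.1 ht.2) htr hs₁far
  have has₀ : s₀ < a := hs₁.1.trans_le ha.1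
  have hbT : b < T := hb.2.trans_lt hs₂.2
  have habmem : Icc a b ⊆ Ioo s₀ T := fun u hu => ⟨has₀.trans_le hu.1, hu.2.trans_lt hbT⟩
  have hnear : ∀ u ∈ Icc a b, ‖x u - q‖ ≤ r := fun u hu =>
    (le_total u t).elim (fun h => hanear u ⟨hu.1, h⟩) fun h => hbnear u ⟨h, hu.2⟩
  have hconc : ConcaveOn ℝ (Icc a b) fun t => clusterInertia m q (x t) :=
    (h.mono (habmem.trans hsub)).concaveOn_clusterInertia hm hR0
      (fun u hu => hR _ (hup u (habmem hu))) (fun u hu => hC (x u) ((hnear u hu).trans hrr))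
      fun u hu => by rw [hE u (hsub (habmem hu))]; exact (hs₀ (habmem hu)).2.1
  have hJt : clusterInertia m q (x t) ≤ d ^ 2 := by
    refine (clusterInertia_le hm q (x t)).trans ?_
    gcongr
  have hd2 : 0 < d ^ 2 := by positivity
  rcases concaveOn_le_left_or_le_right (t := t) hconc with hl | hl
  · have hl' : ∀ u ∈ Icc a t, clusterInertia m q (x u) ≤ d ^ 2 := fun u hu =>
      (hl u hu hb.1.le).trans hJt
    have h1 := hshort a t has₀ ha.2.le ht.2 hanear hl'
    have h2 := hlong a t har (hl' a (left_mem_Icc.2 ha.2.le)) htd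
    linarith
  · have hl' : ∀ u ∈ Icc t b, clusterInertia m q (x u) ≤ d ^ 2 := fun u hu =>
      (hl u hu ha.2.le).trans hJt
    have h1 := hshort t b (hs₁.1.trans ht.1) hb.1.le hbT hbnear hl'
    have h2 := hlong b t hbr (hl' b (right_mem_Icc.2 hb.1.le)) htd
    rw [norm_sub_rev] at h2
    linarith

/-- Every singularity is a collision. -/
theorem IsMaximalSolution.approachesCollisionAt (hα : 2 < α) (hm : ∀ i, 0 < m i) {T : ℝ}
    {x v : ℝ → Config N} (hmax : IsMaximalSolution α m T x v) : ApproachesCollisionAt x T := by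
  have hT : 0 < T := by exact_mod_cast hmax.pos
  have h : SolvesOn α m (Ioo 0 T) x v :=
    (hmax.isSolution.solvesOn hm).mono fun t ht => ⟨ht.1, by exact_mod_cast ht.2⟩
  obtain ⟨E, hE⟩ := h.exists_energy_eq hm isOpen_Ioo isPreconnected_Ioo
  have hU := hmax.tendsto_potential (by linarith) hm
  have hev : ∀ᶠ t in 𝓝[<] T, 4 * E + (2 * α - 4) * potential α m (x t) ≤ 0 := by
    filter_upwards [hU.eventually_le_atBot (-(4 * E) / (2 * α - 4))] with t ht
    rw [le_div_iff₀ (by linarith)] at ht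
    linarith
  obtain ⟨s, hsT, hs⟩ := mem_nhdsLT_iff_exists_Ioo_subset.1 (hev.and (Ioo_mem_nhdsLT hT))
  obtain ⟨I, hI⟩ := exists_tendsto_of_deriv2_nonpos hsT
    (fun t ht => h.hasDerivAt_inertia (hs ht).2) (fun t ht => h.hasDerivAt_virial hm (hs ht).2)
    (fun t ht => by rw [hE t (hs ht).2]; exact (hs ht).1) fun t _ => inertia_nonneg hm (x t)
  obtain ⟨κ, hκ, hκle⟩ := exists_norm_le_massScale hm
  have hbdd : ∀ᶠ t in 𝓝[<] T, x t ∈ Metric.closedBall (0 : Config N) (√(I + 1) / κ) := by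
    filter_upwards [hI.eventually (eventually_le_nhds (lt_add_one I))] with t ht
    rw [mem_closedBall_zero_iff, le_div_iff₀ hκ, mul_comm]
    refine (hκle _).trans (Real.le_sqrt_of_sq_le ?_)
    rwa [norm_sq_massScale hm]
  obtain ⟨q, -, hq⟩ := (isCompact_closedBall (0 : Config N) (√(I + 1) / κ)).exists_mapClusterPt
    (tendsto_principal.2 hbdd)
  have hlim := h.tendsto_of_mapClusterPt hα hm hT hE hU hI hq
  refine ⟨q, ?_, hlim⟩
  by_contra hqΔ
  exact not_tendsto_nhds_of_tendsto_atBot hU _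
    ((continuousAt_potential (α := α) (m := m) hqΔ).tendsto.comp hlim)

/-! ### The dichotomy -/

theorem inertia_pos_of_potential_neg (hm : ∀ i, 0 < m i) {x : Config N} (hx : x ∉ collisionSet N)
    (hU : potential α m x < 0) : 0 < inertia m x := by
  refine (inertia_nonneg hm x).lt_of_ne fun h0 => hU.ne ?_
  have h1 : ∀ i, x i = 0 := fun i => by
    have := (Finset.sum_eq_zero_iff_of_nonneg
      fun i _ => mul_nonneg (hm i).le (sq_nonneg ‖x i‖)).1 h0.symm i (Finset.mem_univ i)
    simpa [(hm i).ne'] using this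
  rw [potential, neg_eq_zero]
  refine Finset.sum_eq_zero fun i _ => Finset.sum_eq_zero fun j hj => ?_
  exact absurd ⟨i, j, by simpa using hj, by rw [h1, h1]⟩ hx

/-- If `K_ω(x) < 0`, then `K_ω(l x) = 0` for some dilation factor `l ≥ 1`, and
`E_ω(l x) = -(α / 2 - 1) l ^ (-α) U(x)` bounds the excited energy. -/
theorem excitedEnergy_le (hα : 2 < α) (hm : ∀ i, 0 < m i) {ω : ℝ} (hω : 0 < ω) {x : Config N}
    (hx : x ∉ collisionSet N) (hK : threshold α m ω x < 0) :
    excitedEnergy α m ω ≤ ((-((α / 2 - 1) * potential α m x) : ℝ) : EReal) := by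
  have hI0 := inertia_nonneg hm x
  rw [threshold] at hK
  have hU : potential α m x < 0 := by
    have h1 : α * potential α m x < 0 := by have := mul_nonneg (sq_nonneg ω) hI0; linarith
    exact (pos_iff_neg_of_mul_neg h1).1 (by linarith)
  have hI := inertia_pos_of_potential_neg hm hx hU
  obtain ⟨b, hb⟩ : ∃ b, b = α * -potential α m x / (ω ^ 2 * inertia m x) := ⟨_, rfl⟩
  have hωI : 0 < ω ^ 2 * inertia m x := by positivity
  have hb1 : 1 ≤ b := by rw [hb, le_div_iff₀ hωI]; linarith
  obtain ⟨l, hl⟩ : ∃ l, l = b ^ (α + 2)⁻¹ := ⟨_, rfl⟩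
  have hl1 : 1 ≤ l := by rw [hl]; exact Real.one_le_rpow hb1 (by positivity)
  have hl0 : 0 < l := by linarith
  have hlb : l ^ (α + 2) = b := by
    rw [hl]; exact Real.rpow_inv_rpow (by linarith) (by linarith)
  have hle : l ^ (-α) ≤ 1 := Real.rpow_le_one_of_one_le_of_nonpos hl1 (by linarith)
  have hbal : ω ^ 2 * (l ^ 2 * inertia m x) = -(α * (l ^ (-α) * potential α m x)) := by
    have h1 : l ^ 2 = l ^ (-α) * b := by
      rw [← hlb, ← Real.rpow_add hl0, ← Real.rpow_natCast]; congr 1; push_cast; ring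
    rw [h1, hb]; field_simp
  have hmem : ((rotatingEnergy α m ω (l • x) : ℝ) : EReal) ∈ {e : EReal | ∃ x : Config N,
      x ∉ collisionSet N ∧ threshold α m ω x = 0 ∧ e = (rotatingEnergy α m ω x : EReal)} := by
    refine ⟨l • x, smul_notMem_collisionSet hx hl0.ne', ?_, rfl⟩
    rw [threshold, inertia_smul, potential_smul _ _ _ hl0, hbal]; ring
  refine (sInf_le hmem).trans (EReal.coe_le_coe_iff.2 ?_)
  rw [rotatingEnergy, inertia_smul, potential_smul _ _ _ hl0, div_mul_eq_mul_div, hbal]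
  have h2 : (α / 2 - 1) * -potential α m x * l ^ (-α) ≤ (α / 2 - 1) * -potential α m x * 1 := by
    have : 0 ≤ (α / 2 - 1) * -potential α m x :=
      mul_nonneg (by linarith) (by linarith)
    gcongr
  linarith

theorem IsMaximalSolution.eq_top_of_staysEventuallyIn_Kplus (hα : 2 < α) (hm : ∀ i, 0 < m i)
    {σ : EReal} {x v : ℝ → Config N} (hmax : IsMaximalSolution α m σ x v) {ω : ℝ}
    (hstay : StaysEventuallyIn σ x v (Kplus α m ω)) : σ = ⊤ := by
  induction σ with
  | bot => exact absurd hmax.pos not_lt_bot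
  | top => rfl
  | coe T =>
    obtain ⟨s, -, hsT, hs⟩ := hstay
    have hsT' : s < T := by exact_mod_cast hsT
    obtain ⟨q, -, hq⟩ := hmax.approachesCollisionAt hα hm
    have hI : Tendsto (fun t => ω ^ 2 * inertia m (x t)) (𝓝[<] T) (𝓝 (ω ^ 2 * inertia m q)) :=
      (((continuous_inertia m).tendsto q).comp hq).const_mul _
    have hU : Tendsto (fun t => α * potential α m (x t)) (𝓝[<] T) atBot :=
      (hmax.tendsto_potential (by linarith) hm).const_mul_atBot (by linarith)
    have hK : Tendsto (fun t => threshold α m ω (x t)) (𝓝[<] T) atBot := hI.add_atBot hU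
    obtain ⟨t, ht, ht'⟩ :=
      ((hK.eventually (eventually_lt_atBot 0)).and (Ioo_mem_nhdsLT hsT')).exists
    exact absurd (hs t ht'.1 (by exact_mod_cast ht'.2)).2.2 (not_le.2 ht)

theorem IsSolutionOn.not_staysEventuallyIn_Kminus (hα : 2 < α) (hm : ∀ i, 0 < m i)
    {x v : ℝ → Config N} (hsol : IsSolutionOn α m ⊤ x v) {ω : ℝ} (hω : 0 < ω) :
    ¬ StaysEventuallyIn ⊤ x v (Kminus α m ω) := by
  rintro ⟨s, hs0, -, hs⟩
  have h : SolvesOn α m (Ioi 0) x v :=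
    (hsol.solvesOn hm).mono fun t ht => ⟨ht, EReal.coe_lt_top t⟩
  obtain ⟨E, hE⟩ := h.exists_energy_eq hm isOpen_Ioi isPreconnected_Ioi
  have hmem : ∀ t ∈ Ici (s + 1), s < t ∧ t ∈ Ioi (0 : ℝ) := fun t ht =>
    have h1 : s + 1 ≤ t := ht
    ⟨by linarith, show 0 < t by linarith⟩
  have hEs : ((E : ℝ) : EReal) < excitedEnergy α m ω := by
    have h1 := hmem (s + 1) self_mem_Ici
    rw [← hE _ h1.2]
    exact (hs _ h1.1 (EReal.coe_lt_top _)).2.1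
  obtain ⟨e, hEe, he⟩ := EReal.lt_iff_exists_real_btwn.1 hEs
  have hEe' : E < e := by exact_mod_cast hEe
  refine not_deriv2_le_neg (s := s + 1) (c := 4 * (e - E)) (by linarith)
    (fun t ht => h.hasDerivAt_inertia (hmem t ht).2)
    (fun t ht => h.hasDerivAt_virial hm (hmem t ht).2) (fun t ht => ?_)
    fun t _ => inertia_nonneg hm (x t)
  obtain ⟨hΔ, -, hK⟩ := hs t (hmem t ht).1 (EReal.coe_lt_top t)
  have h2 : e < -((α / 2 - 1) * potential α m (x t)) := by
    exact_mod_cast he.trans_le (excitedEnergy_le hα hm hω hΔ hK)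
  rw [hE t (hmem t ht).2]
  linarith

end NBody

theorem theorem1p4 (N : ℕ) (m : Fin N → ℝ) (hm : ∀ i, 0 < m i) (α : ℝ) (hα : 2 < α)
    (σ : EReal) (x v : ℝ → NBody.Config N) (hx : NBody.IsMaximalSolution α m σ x v) :
    (∀ ω : ℝ, 0 < ω →
      (NBody.StaysEventuallyIn σ x v (NBody.Kplus α m ω) → NBody.ExistsGlobally σ) ∧
      (NBody.StaysEventuallyIn σ x v (NBody.Kminus α m ω) →
        ∃ T : ℝ, NBody.HasSingularityAt σ T)) ∧
    (∀ T : ℝ, NBody.HasSingularityAt σ T → NBody.ApproachesCollisionAt x T) := by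
  refine ⟨fun ω hω => ⟨hx.eq_top_of_staysEventuallyIn_Kplus hα hm, fun hstay => ?_⟩, ?_⟩
  · induction σ with
    | bot => exact absurd hx.pos not_lt_bot
    | top => exact absurd hstay (hx.isSolution.not_staysEventuallyIn_Kminus hα hm hω)
    | coe T => exact ⟨T, rfl⟩
  · rintro T rfl
    exact hx.approachesCollisionAt hα hm
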